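/- Let $\nu$ be a negative integer, $\alpha<1$ and $b>0$. Put $d=\frac1{1-\alpha}$ and $z=\frac{(1-\alpha)b^2}{4}$, let $\psi=\Gamma'/\Gamma$, $(a)_r=a(a+1)\cdots(a+r-1)$, and ${}_1F_2(a;b_1,b_2;z)=\sum_{r\ge 0}\frac{(a)_r}{(b_1)_r(b_2)_r}\frac{z^r}{r!}$, and read $1/\Gamma$ as $0$ at the poles of $\Gamma$. Then the integral below and both infinite series below converge (absolutely), and $$I_{2\alpha}^{(d)}=\int_0^d x^{\nu}\,[1-(1-\alpha)x]^{\frac1{1-\alpha}}\,e^{-bx^{-1/2}}\,dx=\frac{\Gamma\left(\frac1{1-\alpha}+1\right)}{\sqrt\pi\,(1-\alpha)^{\nu+1}}\bigl\{R_1+R_2+R_3\bigr\},$$ where $$R_1=-\frac{2\sqrt\pi\;\Gamma\left(\frac12+\nu\right)}{\Gamma\left(\frac32+\nu+\frac1{1-\alpha}\right)}\,z^{1/2}\;{}_1F_2\!\left(-\tfrac12-\nu-\tfrac1{1-\alpha};\ \tfrac32,\ \tfrac12-\nu;\ z\right),$$ $$R_2=\frac{\Gamma(-1-\nu)\,\Gamma\left(-\frac12-\nu\right)}{\Gamma\left(1+\frac1{1-\alpha}\right)}\,z^{1+\nu}\sum_{r=0}^{-\nu-2}\frac{\left(-\frac1{1-\alpha}\right)_r}{r!\,\left(\frac32+\nu\right)_r(2+\nu)_r}\,z^r\qquad(R_2=0\text{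 if }\nu=-1),$$ $$R_3=\sum_{r=0}^{\infty}z^r\,\bigl[-\ln z+E'_r\bigr]F'_r,$$ with $$E'_r=\psi\left(\tfrac12-r\right)-\psi\left(\tfrac1{1-\alpha}+2+\nu-r\right)+\psi(1+r)+\psi(r-\nu),$$ $$F'_r=\frac{(-1)^{1+\nu}\,\Gamma\left(\frac12-r\right)}{r!\,(r-\nu-1)!\;\Gamma\left(\frac1{1-\alpha}+2+\nu-r\right)}.$$ If $\frac1{1-\alpha}+2+\nu-r=-n$ for an integer $n\ge0$ (possible only when $\frac1{1-\alpha}$ is an integer), the product $[-\ln z+E'_r]F'_r$ stands for its limiting value $\frac{(-1)^{1+\nu}\Gamma(\frac12-r)}{r!\,(r-\nu-1)!}\,(-1)^n\,n!$. -/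

import Mathlib

noncomputable section

/-- The real psi function `ψ(x) = Γ'(x) / Γ(x)`. -/
def realPsi (x : ℝ) : ℝ := logDeriv Real.Gamma x

/-- The Pochhammer symbol `(a)_r = a (a + 1) ⋯ (a + r - 1)`. -/
def poch (a : ℝ) (r : ℕ) : ℝ := (ascPochhammer ℝ r).eval a

/-- The `r`-th term of the hypergeometric series `₁F₂(a; b, c; z)`. -/
def hyp1F2Term (a b c z : ℝ) (r : ℕ) : ℝ :=
  poch a r / (poch b r * poch c r) * z ^ r / (r.factorial : ℝ)

/-- The generalized hypergeometric function `₁F₂(a; b, c; z)`. -/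
def hyp1F2 (a b c z : ℝ) : ℝ := ∑' r : ℕ, hyp1F2Term a b c z r

/-- The argument `1/(1-α) + 2 + ν - r` of the psi and gamma functions in `E'_r` and `F'_r`. -/
def cutoffArg (ν : ℤ) (α : ℝ) (r : ℕ) : ℝ := 1 / (1 - α) + 2 + (ν : ℝ) - (r : ℝ)

/-- `E'_r = ψ(1/2 - r) - ψ(1/(1-α) + 2 + ν - r) + ψ(1 + r) + ψ(r - ν)`. -/
def cutoffE' (ν : ℤ) (α : ℝ) (r : ℕ) : ℝ :=
  realPsi (1 / 2 - (r : ℝ)) - realPsi (cutoffArg ν α r) + realPsi (1 + (r : ℝ))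
    + realPsi ((r : ℝ) - (ν : ℝ))

/-- The factor `(-1)^(1+ν) Γ(1/2 - r) / (r! (r - ν - 1)!)` of `F'_r` (used for `ν < 0`). -/
def cutoffC' (ν : ℤ) (r : ℕ) : ℝ :=
  (-1 : ℝ) ^ (1 + ν) * Real.Gamma (1 / 2 - (r : ℝ))
    / ((r.factorial : ℝ) * ((((r : ℤ) - ν - 1).toNat).factorial : ℝ))

/-- `F'_r = (-1)^(1+ν) Γ(1/2 - r) / (r! (r - ν - 1)! Γ(1/(1-α) + 2 + ν - r))`. -/
def cutoffF' (ν : ℤ) (α : ℝ) (r : ℕ) : ℝ :=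
  cutoffC' ν r / Real.Gamma (cutoffArg ν α r)

open Classical in
/-- The coefficient `[-log z + E'_r] F'_r`. If `x = 1/(1-α) + 2 + ν - r` is a pole `-n` of `ψ`
and `Γ` (possible only when `1/(1-α)` is an integer), then `F'_r = 0` and `E'_r` is infinite, and
the product is given its limiting value: the limit of `(A - ψ(x)) / Γ(x)` as `x → -n` is
`(-1)^n n!` for every constant `A`. -/
def cutoffLogCoeff (ν : ℤ) (α z : ℝ) (r : ℕ) : ℝ :=
  if ∃ n : ℕ, cutoffArg ν α r = -(n : ℝ) then
    cutoffC' ν r * ((-1 : ℝ) ^ ⌊-cutoffArg ν α r⌋₊ * (⌊-cutoffArg ν α r⌋₊.factorial : ℝ))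
  else (-Real.log z + cutoffE' ν α r) * cutoffF' ν α r

/-- The integrand of `I_{2α}^{(d)}` for `γ - 1 = ν`, `a = 1`, `ρ = 1/2`. -/
def cutoffIntegrand (ν : ℤ) (α b x : ℝ) : ℝ :=
  x ^ ν * (1 - (1 - α) * x) ^ (1 / (1 - α)) * Real.exp (-b * x ^ (-(1 / 2) : ℝ))

end

/-! Write `ν = -N - 1`, `d = 1/(1-α)`, `c = 2√z`. Rescaling by `x = d t` and then putting `t = u⁻²`
turns the integral into `2 (1-α)^N ∫_1^∞ u^(2N-1) (1 - u⁻²)^d e^(-cu) du`. Since `d > 0`, the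
binomial coefficients `a_k` of `(1 - t)^d` are absolutely summable, so the factor `(1 - u⁻²)^d` may
be expanded under the integral sign.

The `k`-th term is an upper incomplete gamma integral of order `2N - 2k`
(`integral_Ioi_one_eq_polarPart_sub`). It is a part singular at `c = 0` (a negative power of `c` if
`k < N`, a multiple of `ψ - log c` if `k ≥ N`) minus the series `∑ (-c)^m / (m! (m + 2N - 2k))`
without its singular term. The double series converges absolutely; summing over `k` first gives
`betaSum` at `-(m + 2N)/2`.

`betaSum` is the beta function `B(s, d+1)` continued to the left by a recurrence. For odd `m` the
argument is a half-integer and the gamma quotient persists (`betaSum_half_sub`): this is `R₁`. For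
even `m` it is a pole and the finite part survives, with `ψ` and `(1/Γ)'` (`betaSum_neg_nat`):
together with the logarithmic parts this is `R₃`. The negative powers of `c` are `R₂`. Since `1/Γ`
is entire, `(1/Γ)'` covers generic `d` and the limiting values for integer `d` alike. -/

open Filter Topology

/-! ### Binomial series of `(1 - t)^d` up to the endpoint `t = 1` -/

/-- The coefficient `(-d)_k / k!` of `t ^ k` in the binomial expansion of `(1 - t) ^ d`. -/
noncomputable def binCoeff (d : ℝ) (k : ℕ) : ℝ := poch (-d) k / (k.factorial : ℝ)

theorem poch_zero (a : ℝ) : poch a 0 = 1 := by simp [poch]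

theorem poch_succ (a : ℝ) (r : ℕ) : poch a (r + 1) = poch a r * (a + r) := by
  simp [poch, ascPochhammer_succ_eval]

theorem binCoeff_zero (d : ℝ) : binCoeff d 0 = 1 := by simp [binCoeff, poch_zero]

theorem binCoeff_succ (d : ℝ) (k : ℕ) :
    ((k : ℝ) + 1) * binCoeff d (k + 1) = (k - d) * binCoeff d k := by
  have h1 : (k.factorial : ℝ) ≠ 0 := by positivity
  have h2 : (k : ℝ) + 1 ≠ 0 := by positivity
  rw [binCoeff, binCoeff, poch_succ, Nat.factorial_succ]
  push_cast
  field_simp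
  ring

/-- Once `k ≥ d`, the recurrence gives `d |a_k| = k |a_k| - (k+1) |a_{k+1}|`, so the partial sums
telescope and stay bounded. -/
theorem summable_abs_binCoeff {d : ℝ} (hd : 0 < d) : Summable fun k => |binCoeff d k| := by
  obtain ⟨m, hm⟩ := exists_nat_ge d
  rw [← summable_nat_add_iff m]
  have key : ∀ k : ℕ, d * |binCoeff d (k + m)| =
      ((k + m : ℕ) : ℝ) * |binCoeff d (k + m)|
        - ((k + 1 + m : ℕ) : ℝ) * |binCoeff d (k + 1 + m)| := by
    intro k
    have h := congrArg abs (binCoeff_succ d (k + m))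
    have h1 : (0 : ℝ) ≤ ((k + m : ℕ) : ℝ) - d := by
      push_cast
      have : (0 : ℝ) ≤ k := by positivity
      linarith
    rw [abs_mul, abs_mul, abs_of_nonneg h1,
      abs_of_nonneg (by positivity : (0 : ℝ) ≤ ((k + m : ℕ) : ℝ) + 1)] at h
    rw [show k + 1 + m = k + m + 1 by ring]
    push_cast at h ⊢
    linarith
  refine summable_of_sum_range_le (c := (m : ℝ) * |binCoeff d m| / d) (fun k => abs_nonneg _) ?_
  intro n
  rw [le_div_iff₀ hd, mul_comm, Finset.mul_sum, Finset.sum_congr rfl fun k _ => key k,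
    Finset.sum_range_sub' fun k : ℕ => ((k + m : ℕ) : ℝ) * |binCoeff d (k + m)|]
  simp only [zero_add, tsub_le_iff_right, le_add_iff_nonneg_right]
  positivity

theorem summable_binCoeff {d : ℝ} (hd : 0 < d) : Summable (binCoeff d) :=
  (summable_abs_binCoeff hd).of_abs

theorem hasSum_binCoeff_mul_pow (d : ℝ) {t : ℝ} (ht0 : 0 ≤ t) (ht1 : t < 1) :
    HasSum (fun k => binCoeff d k * t ^ k) ((1 - t) ^ d) := by
  have h := (Real.one_div_one_sub_rpow_hasFPowerSeriesOnBall_zero (-d)).hasSum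
    (y := t) (by simp [Metric.mem_eball, edist_dist, abs_of_nonneg ht0, ht1])
  have e : ∀ k : ℕ, Ring.choose (-d + k - 1) k = binCoeff d k := by
    intro k
    have h1 := Ring.factorial_nsmul_multichoose_eq_ascPochhammer (-d) k
    rw [Polynomial.ascPochhammer_smeval_eq_eval, Ring.multichoose_eq, nsmul_eq_mul] at h1
    rw [binCoeff, poch, ← h1]
    have : (k.factorial : ℝ) ≠ 0 := by positivity
    field_simp
  simp only [zero_add, Real.rpow_neg (sub_nonneg.2 ht1.le), one_div, inv_inv] at h
  refine (congrArg (HasSum · _) (funext fun k => ?_)).mp h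
  simp [FormalMultilinearSeries.ofScalars, e]

/-- Absolute summability makes the series continuous on `[0, 1]`, so its value at `1` is the limit
of `(1 - t)^d`, which is `0` as `d > 0`. -/
theorem tsum_binCoeff {d : ℝ} (hd : 0 < d) : ∑' k, binCoeff d k = 0 := by
  have hc : ContinuousOn (fun t : ℝ => ∑' k, binCoeff d k * t ^ k) (Set.Icc 0 1) := by
    refine continuousOn_tsum (fun k => by fun_prop) (summable_abs_binCoeff hd) ?_
    intro k t ht
    rw [norm_mul, Real.norm_eq_abs, norm_pow, Real.norm_eq_abs, abs_of_nonneg ht.1]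
    exact mul_le_of_le_one_right (abs_nonneg _) (pow_le_one₀ ht.1 ht.2)
  have h1 : Tendsto (fun t : ℝ => ∑' k, binCoeff d k * t ^ k) (𝓝[Set.Ico 0 1] 1)
      (𝓝 (∑' k, binCoeff d k * 1 ^ k)) :=
    (hc 1 (by simp)).mono_left (nhdsWithin_mono _ Set.Ico_subset_Icc_self)
  have h2 : Tendsto (fun t : ℝ => (1 - t) ^ d) (𝓝[Set.Ico 0 1] 1) (𝓝 ((1 - 1) ^ d)) := by
    have : ContinuousAt (fun t : ℝ => (1 - t) ^ d) 1 :=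
      ContinuousAt.rpow_const (by fun_prop) (Or.inr hd.le)
    exact this.tendsto.mono_left nhdsWithin_le_nhds
  have h3 : Tendsto (fun t : ℝ => (1 - t) ^ d) (𝓝[Set.Ico 0 1] 1)
      (𝓝 (∑' k, binCoeff d k * 1 ^ k)) := by
    refine h1.congr' ?_
    filter_upwards [self_mem_nhdsWithin] with t ht
    exact (hasSum_binCoeff_mul_pow d ht.1 ht.2).tsum_eq
  have : (𝓝[Set.Ico (0 : ℝ) 1] 1).NeBot := by
    rw [nhdsWithin_Ico_eq_nhdsLT (by norm_num)]
    infer_instance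
  have := tendsto_nhds_unique h3 h2
  simpa [Real.zero_rpow hd.ne'] using this

/-! ### The entire function `1/Γ`, its derivative, and `ψ` -/

theorem real_Gamma_inv_eq (x : ℝ) : (Real.Gamma x)⁻¹ = x * (Real.Gamma (x + 1))⁻¹ := by
  rcases eq_or_ne x 0 with rfl | hx
  · simp [Real.Gamma_zero]
  · rw [Real.Gamma_add_one hx, mul_inv, mul_inv_cancel_left₀ hx]

theorem differentiable_real_Gamma_inv : Differentiable ℝ fun x : ℝ => (Real.Gamma x)⁻¹ := by
  intro x
  have h := (Complex.differentiable_one_div_Gamma (x : ℂ)).hasDerivAt.real_of_complex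
  refine (h.congr_of_eventuallyEq (Eventually.of_forall fun y => ?_)).differentiableAt
  simp only [Complex.Gamma_ofReal]
  rw [← Complex.ofReal_inv, Complex.ofReal_re]

/-- The derivative of the entire function `1 / Γ` on the real line. -/
noncomputable def derivGammaInv (x : ℝ) : ℝ := deriv (fun y => (Real.Gamma y)⁻¹) x

theorem hasDerivAt_Gamma_inv (x : ℝ) :
    HasDerivAt (fun y => (Real.Gamma y)⁻¹) (derivGammaInv x) x :=
  (differentiable_real_Gamma_inv x).hasDerivAt

theorem derivGammaInv_eq (x : ℝ) :
    derivGammaInv x = (Real.Gamma (x + 1))⁻¹ + x * derivGammaInv (x + 1) := by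
  have h1 : HasDerivAt (fun y : ℝ => y * (Real.Gamma (y + 1))⁻¹)
      (1 * (Real.Gamma (x + 1))⁻¹ + x * derivGammaInv (x + 1)) x :=
    (hasDerivAt_id x).mul ((hasDerivAt_Gamma_inv (x + 1)).comp_add_const x 1)
  have h2 : (fun y : ℝ => (Real.Gamma y)⁻¹) = fun y => y * (Real.Gamma (y + 1))⁻¹ :=
    funext real_Gamma_inv_eq
  rw [derivGammaInv, h2, h1.deriv, one_mul]

theorem derivGammaInv_eq_psi {x : ℝ} (hx : ∀ n : ℕ, x ≠ -n) :
    derivGammaInv x = -realPsi x / Real.Gamma x := by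
  have h := (Real.differentiableAt_Gamma hx).hasDerivAt.inv (Real.Gamma_ne_zero hx)
  have h' : derivGammaInv x = _ := h.deriv
  rw [h', realPsi, logDeriv_apply]
  field_simp

/-- Source of the limiting values in `R₃`: `(A - ψ)/Γ = A/Γ + (1/Γ)'`, and at a pole of `Γ` only the
second summand remains. -/
theorem derivGammaInv_neg_nat (n : ℕ) :
    derivGammaInv (-n) = (-1) ^ n * (n.factorial : ℝ) := by
  induction n with
  | zero =>
    rw [derivGammaInv_eq]
    simp
  | succ n ih =>
    rw [derivGammaInv_eq]
    have h : -((n + 1 : ℕ) : ℝ) + 1 = -n := by push_cast; ring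
    rw [h, ih, Real.Gamma_neg_nat_eq_zero, Nat.factorial_succ]
    push_cast
    ring

theorem hasDerivAt_Gamma_psi {x : ℝ} (hx : ∀ n : ℕ, x ≠ -n) :
    HasDerivAt Real.Gamma (Real.Gamma x * realPsi x) x := by
  have h := (Real.differentiableAt_Gamma hx).hasDerivAt
  rwa [realPsi, logDeriv_apply, mul_div_cancel₀ _ (Real.Gamma_ne_zero hx)]

theorem realPsi_add_one {x : ℝ} (hx : ∀ n : ℕ, x ≠ -n) :
    realPsi (x + 1) = realPsi x + 1 / x := by
  have hx0 : x ≠ 0 := by simpa using hx 0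
  have hx1 : ∀ n : ℕ, x + 1 ≠ -n := fun n h => hx (n + 1) (by push_cast; linarith)
  have h := derivGammaInv_eq x
  rw [derivGammaInv_eq_psi hx, derivGammaInv_eq_psi hx1, Real.Gamma_add_one hx0] at h
  have := Real.Gamma_ne_zero hx
  field_simp at h ⊢
  linarith

theorem ne_neg_nat_of_pos {x : ℝ} (hx : 0 < x) (n : ℕ) : x ≠ -n := by
  have : (0 : ℝ) ≤ n := n.cast_nonneg
  intro h
  linarith

theorem half_sub_ne_neg_nat (m : ℤ) (n : ℕ) : (1 / 2 + m : ℝ) ≠ -n := by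
  intro h
  have h2 : ((1 + 2 * m : ℤ) : ℝ) = ((-2 * (n : ℤ) : ℤ) : ℝ) := by
    push_cast
    linarith
  have := Int.cast_injective h2
  omega

theorem realPsi_one_half : realPsi (1 / 2) = realPsi 1 - 2 * Real.log 2 := by
  rw [realPsi, realPsi, logDeriv_apply, logDeriv_apply, Real.hasDerivAt_Gamma_one_half.deriv,
    Real.hasDerivAt_Gamma_one.deriv, Real.Gamma_one_half_eq, Real.Gamma_one]
  have : √Real.pi ≠ 0 := by positivity
  field_simp
  ring

/-- Legendre duplication combined with `ψ(1/2 - n) = ψ(1/2 + n)`; here both sides grow by `2/(2n+1)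
+ 1/(n+1)` at each step. It trades the `ψ(2n+1)` of the incomplete gamma integrals for the psi
values in `E'_r`. -/
theorem realPsi_duplication (n : ℕ) :
    2 * realPsi (2 * n + 1)
      = realPsi (1 / 2 - n) + realPsi (1 + n) + 2 * Real.log 2 := by
  induction n with
  | zero =>
    simp only [Nat.cast_zero, mul_zero, zero_add, sub_zero, add_zero, realPsi_one_half]
    ring
  | succ n ih =>
    have e1 := realPsi_add_one (x := 2 * n + 1) (ne_neg_nat_of_pos (by positivity))
    have e2 := realPsi_add_one (x := 2 * n + 1 + 1) (ne_neg_nat_of_pos (by positivity))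
    have e3 := realPsi_add_one (x := 1 + (n : ℝ)) (ne_neg_nat_of_pos (by positivity))
    have e4 := realPsi_add_one (x := 1 / 2 - ((n : ℝ) + 1)) (by
      intro k
      have := half_sub_ne_neg_nat (-((n : ℤ) + 1)) k
      push_cast at this
      convert this using 1
      ring)
    have e5 : (1 / 2 - ((n : ℝ) + 1)) + 1 = 1 / 2 - n := by ring
    have e6 : (2 * ((n : ℝ) + 1) + 1) = 2 * n + 1 + 1 + 1 := by ring
    have e7 : 1 + ((n : ℝ) + 1) = 1 + n + 1 := by ring
    push_cast
    rw [e5] at e4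
    rw [e6, e7, e2, e1, e3, ← sub_eq_of_eq_add e4]
    have h1 : 1 / (2 * (n : ℝ) + 1 + 1) = 1 / (1 + n) / 2 := by
      field_simp
      ring
    have h2 : 1 / (1 / 2 - ((n : ℝ) + 1)) = -2 * (1 / (2 * n + 1)) := by
      rw [show (1 / 2 - ((n : ℝ) + 1)) = -((2 * n + 1) / 2) by ring]
      field_simp
    rw [h1, h2]
    linarith

/-! ### The continued beta function and its finite parts -/

/-- The sum `∑ (-d)_k / (k! (k + s))`, which continues the beta integral `B(s, d + 1)`;
at `s = -K` the convention `x / 0 = 0` omits the singular term. -/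
noncomputable def betaSum (d s : ℝ) : ℝ := ∑' k : ℕ, binCoeff d k / (k + s)

theorem summable_div_of_one_le {a u : ℕ → ℝ} (ha : Summable fun k => |a k|)
    (hu : ∀ᶠ k in atTop, 1 ≤ |u k|) : Summable fun k => a k / u k := by
  refine Summable.of_norm_bounded_eventually_nat ha ?_
  filter_upwards [hu] with k hk
  rw [norm_div, Real.norm_eq_abs, Real.norm_eq_abs]
  exact div_le_self (abs_nonneg _) hk

theorem summable_betaSum {d : ℝ} (hd : 0 < d) (s : ℝ) :
    Summable fun k : ℕ => binCoeff d k / (k + s) := by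
  refine summable_div_of_one_le (summable_abs_binCoeff hd) ?_
  filter_upwards [(tendsto_natCast_atTop_atTop (R := ℝ)).eventually_ge_atTop (1 - s)] with k hk
  exact (by linarith : 1 ≤ (k : ℝ) + s).trans (le_abs_self _)

open Classical in
theorem summable_ite_binCoeff {d : ℝ} (hd : 0 < d) (s : ℝ) :
    Summable fun k : ℕ => if (k : ℝ) + s = 0 then binCoeff d k else 0 := by
  refine Summable.of_norm_bounded (summable_abs_binCoeff hd) fun k => ?_
  split_ifs <;> simp

open Classical in
-- From `k/(k+s) = 1 - s/(k+s)` and `∑ a_k = 0`, the sum of `k a_k/(k+s)` is `-s betaSum d s`;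
-- shifting the index with `(k+1) a_{k+1} = (k-d) a_k` relates it to `s + 1`. The conditional sums
-- correct for a vanishing denominator, where the division convention drops the term.
theorem betaSum_recurrence {d : ℝ} (hd : 0 < d) (s : ℝ) :
    s * betaSum d s = (s + 1 + d) * betaSum d (s + 1)
      + (∑' k : ℕ, if (k : ℝ) + (s + 1) = 0 then binCoeff d k else 0)
      - ∑' k : ℕ, if (k : ℝ) + s = 0 then binCoeff d k else 0 := by
  have key : ∀ (x s y : ℝ), y * (x / (y + s)) = x - s * (x / (y + s))
      - if y + s = 0 then x else 0 := by
    intro x s y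
    split_ifs with h
    · simp [h]
    · field_simp
      ring
  have hS := fun s => (summable_betaSum hd s).hasSum
  have hI := fun s => (summable_ite_binCoeff hd s).hasSum
  have hA : HasSum (binCoeff d) 0 := tsum_binCoeff hd ▸ (summable_binCoeff hd).hasSum
  have h1 : HasSum (fun k : ℕ => (k : ℝ) * (binCoeff d k / (k + s)))
      (0 - s * betaSum d s - ∑' k : ℕ, if (k : ℝ) + s = 0 then binCoeff d k else 0) := by
    refine (congrArg (HasSum · _) (funext fun k => ?_)).mp
      ((hA.sub ((hS s).mul_left s)).sub (hI s))
    rw [key]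
  have h2 : HasSum (fun k : ℕ => (k : ℝ) * (binCoeff d k / (k + (s + 1))))
      (0 - (s + 1) * betaSum d (s + 1)
        - ∑' k : ℕ, if (k : ℝ) + (s + 1) = 0 then binCoeff d k else 0) := by
    refine (congrArg (HasSum · _) (funext fun k => ?_)).mp
      ((hA.sub ((hS (s + 1)).mul_left (s + 1))).sub (hI (s + 1)))
    rw [key]
  have h3 := h2.sub ((hS (s + 1)).mul_left d)
  have h4 := (hasSum_nat_add_iff' 1).mpr h1
  have h5 : (fun k : ℕ => ((k + 1 : ℕ) : ℝ) * (binCoeff d (k + 1) / (((k + 1 : ℕ) : ℝ) + s)))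
      = fun k : ℕ => (k : ℝ) * (binCoeff d k / (k + (s + 1)))
        - d * (binCoeff d k / (k + (s + 1))) := by
    funext k
    have h := binCoeff_succ d k
    rw [← sub_mul, ← mul_div_assoc, ← mul_div_assoc, ← h]
    push_cast
    ring_nf
  rw [h5] at h4
  have h6 := h4.unique h3
  simp only [Finset.range_one, Finset.sum_singleton, Nat.cast_zero, zero_mul, sub_zero] at h6
  change 0 - s * betaSum d s - _ = 0 - (s + 1) * betaSum d (s + 1) - _ - d * betaSum d (s + 1) at h6
  linarith

theorem betaSum_of_pos {d s : ℝ} (hd : 0 < d) (hs : 0 < s) :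
    betaSum d s = Real.Gamma s * Real.Gamma (d + 1) * (Real.Gamma (s + d + 1))⁻¹ := by
  have hb : ∫ t in (0 : ℝ)..1, t ^ (s - 1) * (1 - t) ^ d
      = Real.Gamma s * Real.Gamma (d + 1) * (Real.Gamma (s + d + 1))⁻¹ := by
    have h := Complex.betaIntegral_eq_Gamma_mul_div (u := (s : ℂ)) (v := ((d + 1 : ℝ) : ℂ))
      (by simpa using hs) (by rw [Complex.ofReal_re]; linarith)
    rw [← Complex.ofReal_add, Complex.Gamma_ofReal, Complex.Gamma_ofReal, Complex.Gamma_ofReal]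
      at h
    have h2 : Complex.betaIntegral s ((d + 1 : ℝ) : ℂ)
        = ((∫ t in (0 : ℝ)..1, t ^ (s - 1) * (1 - t) ^ d : ℝ) : ℂ) := by
      rw [Complex.betaIntegral, ← intervalIntegral.integral_ofReal]
      refine intervalIntegral.integral_congr fun t ht => ?_
      rw [Set.uIcc_of_le zero_le_one] at ht
      simp only [Complex.ofReal_mul, Complex.ofReal_cpow ht.1,
        Complex.ofReal_cpow (sub_nonneg.2 ht.2)]
      push_cast
      rw [add_sub_cancel_right]
    rw [h2] at h
    rw [← div_eq_mul_inv, add_assoc]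
    exact_mod_cast h
  have hsum : HasSum (fun k : ℕ => ∫ t in (0 : ℝ)..1, binCoeff d k * t ^ ((k : ℝ) + s - 1))
      (∫ t in (0 : ℝ)..1, t ^ (s - 1) * (1 - t) ^ d) := by
    refine intervalIntegral.hasSum_integral_of_dominated_convergence
      (fun k t => |binCoeff d k| * t ^ (s - 1)) ?_ ?_ ?_ ?_ ?_
    · intro k
      exact (by fun_prop : Measurable fun t : ℝ =>
        binCoeff d k * t ^ ((k : ℝ) + s - 1)).aestronglyMeasurable
    · intro k
      refine Eventually.of_forall fun t ht => ?_
      rw [Set.uIoc_of_le zero_le_one] at ht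
      rw [norm_mul, Real.norm_eq_abs, Real.norm_eq_abs, abs_of_nonneg (Real.rpow_nonneg ht.1.le _)]
      refine mul_le_mul_of_nonneg_left (Real.rpow_le_rpow_of_exponent_ge ht.1 ht.2 ?_)
        (abs_nonneg _)
      have : (0 : ℝ) ≤ k := k.cast_nonneg
      linarith
    · exact Eventually.of_forall fun t _ => (summable_abs_binCoeff hd).mul_right _
    · simp_rw [tsum_mul_right]
      exact (intervalIntegral.intervalIntegrable_rpow' (by linarith)).const_mul _
    -- The binomial expansion is available for `t < 1` only; the endpoint is a null set.
    · have h1 : ∀ᵐ t : ℝ, t ≠ 1 := by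
        simp [MeasureTheory.ae_iff]
      filter_upwards [h1] with t ht1 ht
      rw [Set.uIoc_of_le zero_le_one] at ht
      have := (hasSum_binCoeff_mul_pow d ht.1.le (lt_of_le_of_ne ht.2 ht1)).mul_left (t ^ (s - 1))
      refine (congrArg (HasSum · _) (funext fun k => ?_)).mp this
      rw [add_sub_assoc, Real.rpow_add ht.1, Real.rpow_natCast]
      ring
  rw [← hb, ← hsum.tsum_eq, betaSum]
  refine tsum_congr fun k => ?_
  have hk : (0 : ℝ) ≤ k := k.cast_nonneg
  rw [intervalIntegral.integral_const_mul, integral_rpow (Or.inl (by linarith)),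
    Real.one_rpow, Real.zero_rpow (by linarith)]
  ring_nf

theorem betaSum_step {d s : ℝ} (hd : 0 < d) (hs : ∀ n : ℕ, s ≠ -n)
    (h : betaSum d (s + 1) =
      Real.Gamma (s + 1) * Real.Gamma (d + 1) * (Real.Gamma (s + 1 + d + 1))⁻¹) :
    betaSum d s = Real.Gamma s * Real.Gamma (d + 1) * (Real.Gamma (s + d + 1))⁻¹ := by
  have hs0 : s ≠ 0 := by simpa using hs 0
  have h0 : ∀ k : ℕ, ¬ ((k : ℝ) + s = 0) := fun k hk => hs k (by linarith)
  have h1 : ∀ k : ℕ, ¬ ((k : ℝ) + (s + 1) = 0) := fun k hk => hs (k + 1) (by push_cast; linarith)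
  have hr := betaSum_recurrence hd s
  simp only [h0, h1, if_false, tsum_zero, add_zero, sub_zero] at hr
  rw [h, Real.Gamma_add_one hs0, show s + 1 + d + 1 = s + d + 1 + 1 by ring] at hr
  rw [real_Gamma_inv_eq (s + d + 1)]
  refine mul_left_cancel₀ hs0 ?_
  rw [hr]
  ring

theorem betaSum_half_sub {d : ℝ} (hd : 0 < d) (j : ℕ) :
    betaSum d (1 / 2 - j)
      = Real.Gamma (1 / 2 - j) * Real.Gamma (d + 1) * (Real.Gamma (1 / 2 - j + d + 1))⁻¹ := by
  induction j with
  | zero => exact betaSum_of_pos hd (by norm_num)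
  | succ j ih =>
    refine betaSum_step hd (fun n => ?_) ?_
    · have := half_sub_ne_neg_nat (-((j : ℤ) + 1)) n
      push_cast at this ⊢
      rwa [← sub_eq_add_neg] at this
    · rw [show 1 / 2 - ((j + 1 : ℕ) : ℝ) + 1 = 1 / 2 - j by push_cast; ring, ih]

/-- For `s > 0`, removing the `k = 0` term leaves `B(s, d+1) - 1/s`. This is the difference quotient
at `0` of `s B(s, d+1) = Γ(s+1) Γ(d+1) / Γ(s+d+1)`, whose value at `0` is `1`. Let `s → 0+`. -/
theorem betaSum_zero {d : ℝ} (hd : 0 < d) :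
    betaSum d 0 = realPsi 1 + Real.Gamma (d + 1) * derivGammaInv (d + 1) := by
  have hne : Real.Gamma (d + 1) ≠ 0 := (Real.Gamma_pos_of_pos (by linarith)).ne'
  have hder : HasDerivAt
      (fun s : ℝ => Real.Gamma (s + 1) * Real.Gamma (d + 1) * (Real.Gamma (s + (d + 1)))⁻¹)
      (realPsi 1 + Real.Gamma (d + 1) * derivGammaInv (d + 1)) 0 := by
    have h1 : HasDerivAt (fun s : ℝ => Real.Gamma (s + 1)) (Real.Gamma (0 + 1) * realPsi (0 + 1)) 0 :=
      (hasDerivAt_Gamma_psi (x := 0 + 1) (ne_neg_nat_of_pos (by norm_num))).comp_add_const 0 1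
    have h2 : HasDerivAt (fun s : ℝ => (Real.Gamma (s + (d + 1)))⁻¹) (derivGammaInv (0 + (d + 1))) 0 :=
      (hasDerivAt_Gamma_inv (0 + (d + 1))).comp_add_const 0 (d + 1)
    refine ((h1.mul_const (Real.Gamma (d + 1))).mul h2).congr_deriv ?_
    simp only [zero_add, Real.Gamma_one]
    field_simp
  have hlim1 := (hasDerivAt_iff_tendsto_slope_zero.mp hder).mono_left
    (nhdsWithin_mono 0 (fun x (hx : 0 < x) => hx.ne' : Set.Ioi (0 : ℝ) ⊆ {0}ᶜ))
  have hlim2 : Tendsto (fun s : ℝ => ∑' k : ℕ, if k = 0 then 0 else binCoeff d k / (k + s))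
      (𝓝[>] 0) (𝓝 (∑' k : ℕ, if k = 0 then 0 else binCoeff d k / (k + 0))) := by
    refine tendsto_tsum_of_dominated_convergence (summable_abs_binCoeff hd) ?_ ?_
    · intro k
      by_cases hk : k = 0
      · simp [hk]
      · simp only [hk, if_false]
        refine Tendsto.mono_left ?_ nhdsWithin_le_nhds
        have hk' : (k : ℝ) + 0 ≠ 0 := by simpa using hk
        exact (ContinuousAt.div (by fun_prop) (by fun_prop) hk' :
          ContinuousAt (fun s : ℝ => binCoeff d k / (k + s)) 0)
    · filter_upwards [self_mem_nhdsWithin] with s (hs : 0 < s) k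
      by_cases hk : k = 0
      · simp [hk]
      · simp only [hk, if_false]
        have hk' : (1 : ℝ) ≤ k := by exact_mod_cast Nat.one_le_iff_ne_zero.mpr hk
        rw [norm_div, Real.norm_eq_abs, Real.norm_eq_abs, abs_of_pos (by linarith : 0 < (k : ℝ) + s)]
        exact div_le_self (abs_nonneg _) (by linarith)
  have hzero : ∑' k : ℕ, (if k = 0 then 0 else binCoeff d k / ((k : ℝ) + 0)) = betaSum d 0 := by
    refine tsum_congr fun k => ?_
    split_ifs with hk <;> simp [hk]
  rw [hzero] at hlim2
  refine tendsto_nhds_unique hlim2 (hlim1.congr' ?_)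
  filter_upwards [self_mem_nhdsWithin] with s (hs : 0 < s)
  have h1 := betaSum_of_pos hd hs
  have h2 := (summable_betaSum hd s).tsum_eq_add_tsum_ite 0
  rw [← betaSum, h1] at h2
  simp only [Nat.cast_zero, zero_add, binCoeff_zero] at h2
  rw [zero_add, zero_add, zero_add, Real.Gamma_one, one_mul, mul_inv_cancel₀ hne,
    Real.Gamma_add_one hs.ne', smul_eq_mul, ← add_assoc]
  have h3 : ∀ X Y : ℝ, X = 1 / s + Y → s⁻¹ * (s * X - 1) = Y := by
    intro X Y h
    rw [h]
    field_simp
    ring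
  rw [← h3 _ _ h2]
  ring

/-- The two formulas go through one induction because the recurrence at a pole involves `a_K` and
`a_{K+1}` as correction terms. -/
theorem betaSum_neg_nat {d : ℝ} (hd : 0 < d) (K : ℕ) :
    betaSum d (-K) = (-1) ^ K * Real.Gamma (d + 1) / (K.factorial : ℝ)
      * (realPsi (K + 1) * (Real.Gamma (d + 1 - K))⁻¹ + derivGammaInv (d + 1 - K)) ∧
    binCoeff d K = (-1) ^ K * Real.Gamma (d + 1) / (K.factorial : ℝ)
      * (Real.Gamma (d + 1 - K))⁻¹ := by
  classical
  have hite : ∀ n : ℕ, (∑' k : ℕ, if (k : ℝ) + (-n) = 0 then binCoeff d k else 0)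
      = binCoeff d n := by
    intro n
    rw [tsum_eq_single n]
    · simp
    · intro k hk
      rw [if_neg]
      intro h
      exact hk (Nat.cast_injective (R := ℝ) (by linarith))
  induction K with
  | zero =>
    have hne : Real.Gamma (d + 1) ≠ 0 := (Real.Gamma_pos_of_pos (by linarith)).ne'
    simp only [Nat.cast_zero, neg_zero, betaSum_zero hd, pow_zero, Nat.factorial_zero,
      Nat.cast_one, zero_add, sub_zero, binCoeff_zero]
    constructor <;> field_simp
  | succ K ih =>
    obtain ⟨ih1, ih2⟩ := ih
    have hK : ((K : ℝ) + 1) ≠ 0 := by positivity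
    have hf : (K.factorial : ℝ) ≠ 0 := by positivity
    have hx : d + 1 - (K : ℝ) = d + 1 - ((K + 1 : ℕ) : ℝ) + 1 := by push_cast; ring
    have hg := real_Gamma_inv_eq (d + 1 - ((K + 1 : ℕ) : ℝ))
    have hv := derivGammaInv_eq (d + 1 - ((K + 1 : ℕ) : ℝ))
    rw [← hx] at hg hv
    have ha := binCoeff_succ d K
    have ha' : binCoeff d (K + 1) = (-1) ^ (K + 1) * Real.Gamma (d + 1) / ((K + 1).factorial : ℝ)
        * (Real.Gamma (d + 1 - ((K + 1 : ℕ) : ℝ)))⁻¹ := by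
      refine mul_left_cancel₀ hK ?_
      rw [ha, ih2, hg, Nat.factorial_succ]
      push_cast
      generalize (Real.Gamma (d + 1 - K))⁻¹ = g
      field_simp
      ring
    refine ⟨?_, ha'⟩
    have hr := betaSum_recurrence hd (-((K + 1 : ℕ) : ℝ))
    rw [show -((K + 1 : ℕ) : ℝ) + 1 = -(K : ℝ) by push_cast; ring, hite, hite, ih1, ha', ih2] at hr
    have hp := realPsi_add_one (x := (K : ℝ) + 1) (ne_neg_nat_of_pos (by positivity))
    refine mul_left_cancel₀ (neg_ne_zero.mpr hK) ?_
    push_cast at hr hg hv ⊢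
    rw [hr, hp, hv, hg, Nat.factorial_succ]
    push_cast
    generalize (Real.Gamma (d + 1 - K))⁻¹ = g
    field_simp
    ring

/-! ### Upper incomplete gamma integrals and their expansions in `c` -/

open MeasureTheory Set

/-- The coefficient `(-c)^m / m!` of the exponential series of `exp (-c)`. -/
noncomputable def expCoeff (c : ℝ) (m : ℕ) : ℝ := (-c) ^ m / (m.factorial : ℝ)

/-- The sum `∑ (-c)^m / (m! (m + s))`; at `s = -n` the convention `x / 0 = 0` omits the
singular term. -/
noncomputable def expSum (c s : ℝ) : ℝ := ∑' m : ℕ, expCoeff c m / (m + s)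

theorem hasSum_expCoeff_mul_pow (c t : ℝ) :
    HasSum (fun m => expCoeff c m * t ^ m) (Real.exp (-(c * t))) := by
  have h := NormedSpace.expSeries_div_hasSum_exp (-(c * t))
  rw [← Real.exp_eq_exp_ℝ] at h
  refine (congrArg (HasSum · _) (funext fun m => ?_)).mp h
  rw [expCoeff, ← neg_mul, mul_pow]
  ring

theorem hasSum_expCoeff (c : ℝ) : HasSum (expCoeff c) (Real.exp (-c)) := by
  simpa using hasSum_expCoeff_mul_pow c 1

theorem summable_abs_expCoeff (c : ℝ) : Summable fun m => |expCoeff c m| :=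
  (hasSum_expCoeff c).summable.abs

theorem expCoeff_succ (c : ℝ) (m : ℕ) :
    ((m : ℝ) + 1) * expCoeff c (m + 1) = -c * expCoeff c m := by
  have h1 : (m.factorial : ℝ) ≠ 0 := by positivity
  have h2 : (m : ℝ) + 1 ≠ 0 := by positivity
  rw [expCoeff, expCoeff, Nat.factorial_succ]
  push_cast
  field_simp
  ring

theorem summable_expSum (c s : ℝ) : Summable fun m : ℕ => expCoeff c m / (m + s) := by
  refine summable_div_of_one_le (summable_abs_expCoeff c) ?_
  filter_upwards [(tendsto_natCast_atTop_atTop (R := ℝ)).eventually_ge_atTop (1 - s)] with k hk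
  exact (by linarith : 1 ≤ (k : ℝ) + s).trans (le_abs_self _)

/-- The series counterpart of integration by parts; the extra `expCoeff c (n + 1)` makes up for the
omitted term `m = n + 1`. -/
theorem expSum_neg_nat_recurrence (c : ℝ) (n : ℕ) :
    ((n : ℝ) + 1) * expSum c (-((n : ℝ) + 1))
      = -c * expSum c (-(n : ℝ)) - Real.exp (-c) + expCoeff c (n + 1) := by
  classical
  have h1 := (summable_expSum c (-((n : ℝ) + 1))).hasSum.mul_left ((n : ℝ) + 1)
  have h2 : HasSum (fun m : ℕ => if m = n + 1 then expCoeff c (n + 1) else 0)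
      (expCoeff c (n + 1)) := hasSum_ite_eq _ _
  have h3 := (h1.add (hasSum_expCoeff c)).sub h2
  have h4 : ∀ m : ℕ, ((n : ℝ) + 1) * (expCoeff c m / (m + -((n : ℝ) + 1))) + expCoeff c m
      - (if m = n + 1 then expCoeff c (n + 1) else 0)
      = m * expCoeff c m / (m + -((n : ℝ) + 1)) := by
    intro m
    split_ifs with h
    · subst h
      simp
    · have : (m : ℝ) + -((n : ℝ) + 1) ≠ 0 := by
        intro h0
        exact h (Nat.cast_injective (R := ℝ) (by push_cast; linarith))
      field_simp
      ring
  simp only [h4] at h3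
  have h5 := (hasSum_nat_add_iff' 1).mpr h3
  have h6 := (summable_expSum c (-(n : ℝ))).hasSum.mul_left (-c)
  have h7 : (fun m : ℕ => ((m + 1 : ℕ) : ℝ) * expCoeff c (m + 1)
      / (((m + 1 : ℕ) : ℝ) + -((n : ℝ) + 1))) = fun m : ℕ => -c * (expCoeff c m / (m + -(n : ℝ))) := by
    funext m
    have h := expCoeff_succ c m
    push_cast
    rw [h, mul_div_assoc]
    ring_nf
  rw [h7] at h5
  have h8 := h5.unique h6
  simp only [Finset.range_one, Finset.sum_singleton, Nat.cast_zero, zero_mul, zero_div,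
    sub_zero] at h8
  change ((n : ℝ) + 1) * expSum c (-((n : ℝ) + 1)) + _ - _ = -c * expSum c (-(n : ℝ)) at h8
  linarith

theorem integrableOn_rpow_mul_exp_Ioi_zero {c s : ℝ} (hc : 0 < c) (hs : -1 < s) :
    IntegrableOn (fun u : ℝ => u ^ s * Real.exp (-(c * u))) (Ioi 0) := by
  have h := integrableOn_rpow_mul_exp_neg_mul_rpow hs (zero_lt_one) hc
  simpa only [Real.rpow_one, neg_mul] using h

theorem integrableOn_rpow_mul_exp_Ioi_one {c : ℝ} (hc : 0 < c) (s : ℝ) :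
    IntegrableOn (fun u : ℝ => u ^ s * Real.exp (-(c * u))) (Ioi 1) := by
  have h := (integrableOn_rpow_mul_exp_Ioi_zero (s := max s 0) hc
    (by have := le_max_right s 0; linarith)).mono_set (Ioi_subset_Ioi zero_le_one)
  refine Integrable.mono' h
    (by fun_prop : Measurable fun u : ℝ => u ^ s * Real.exp (-(c * u))).aestronglyMeasurable ?_
  filter_upwards [ae_restrict_mem measurableSet_Ioi] with u (hu : 1 < u)
  have hu0 : 0 < u := zero_lt_one.trans hu
  rw [Real.norm_eq_abs, abs_of_nonneg (by positivity)]
  gcongr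
  · exact hu.le
  · exact le_max_left _ _

/-- The full gamma integral minus its part over `(0, 1)`, where the exponential series is integrated
termwise. -/
theorem integral_Ioi_one_rpow_mul_exp {c s : ℝ} (hc : 0 < c) (hs : 0 < s) :
    ∫ u in Ioi (1 : ℝ), u ^ (s - 1) * Real.exp (-(c * u))
      = (1 / c) ^ s * Real.Gamma s - expSum c s := by
  have h0 : IntegrableOn (fun u : ℝ => u ^ (s - 1) * Real.exp (-(c * u))) (Ioi 0) :=
    integrableOn_rpow_mul_exp_Ioi_zero hc (by linarith)
  have h1 := Real.integral_rpow_mul_exp_neg_mul_Ioi hs hc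
  have h2 := setIntegral_union (Ioc_disjoint_Ioi le_rfl : Disjoint (Ioc (0 : ℝ) 1) (Ioi 1))
    measurableSet_Ioi (h0.mono_set Ioc_subset_Ioi_self) (h0.mono_set (Ioi_subset_Ioi zero_le_one))
  rw [Ioc_union_Ioi_eq_Ioi zero_le_one, h1, ← intervalIntegral.integral_of_le zero_le_one] at h2
  have hsum : HasSum (fun m : ℕ => ∫ t in (0 : ℝ)..1, expCoeff c m * t ^ ((m : ℝ) + s - 1))
      (∫ t in (0 : ℝ)..1, t ^ (s - 1) * Real.exp (-(c * t))) := by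
    refine intervalIntegral.hasSum_integral_of_dominated_convergence
      (fun m t => |expCoeff c m| * t ^ (s - 1)) ?_ ?_ ?_ ?_ ?_
    · intro m
      exact (by fun_prop : Measurable fun t : ℝ =>
        expCoeff c m * t ^ ((m : ℝ) + s - 1)).aestronglyMeasurable
    · intro m
      refine Eventually.of_forall fun t ht => ?_
      rw [Set.uIoc_of_le zero_le_one] at ht
      rw [norm_mul, Real.norm_eq_abs, Real.norm_eq_abs, abs_of_nonneg (Real.rpow_nonneg ht.1.le _)]
      refine mul_le_mul_of_nonneg_left (Real.rpow_le_rpow_of_exponent_ge ht.1 ht.2 ?_)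
        (abs_nonneg _)
      have : (0 : ℝ) ≤ m := m.cast_nonneg
      linarith
    · exact Eventually.of_forall fun t _ => (summable_abs_expCoeff c).mul_right _
    · simp_rw [tsum_mul_right]
      exact (intervalIntegral.intervalIntegrable_rpow' (by linarith)).const_mul _
    · refine Eventually.of_forall fun t ht => ?_
      rw [Set.uIoc_of_le zero_le_one] at ht
      have := (hasSum_expCoeff_mul_pow c t).mul_left (t ^ (s - 1))
      refine (congrArg (HasSum · _) (funext fun m => ?_)).mp this
      rw [add_sub_assoc, Real.rpow_add ht.1, Real.rpow_natCast]
      ring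
  have h3 : ∫ t in (0 : ℝ)..1, t ^ (s - 1) * Real.exp (-(c * t)) = expSum c s := by
    rw [← hsum.tsum_eq, expSum]
    refine tsum_congr fun m => ?_
    have hm : (0 : ℝ) ≤ m := m.cast_nonneg
    rw [intervalIntegral.integral_const_mul, integral_rpow (Or.inl (by linarith)),
      Real.one_rpow, Real.zero_rpow (by linarith)]
    ring_nf
  rw [h3] at h2
  linarith

/-- Limit `s → 0+` of the previous formula: the pole of `c^(-s) Γ(s)` cancels the term `1/s` of the
series, leaving the derivative of `c^(-s) Γ(s+1)` at `0`. -/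
theorem integral_Ioi_one_inv_mul_exp {c : ℝ} (hc : 0 < c) :
    ∫ u in Ioi (1 : ℝ), u ^ (-1 : ℝ) * Real.exp (-(c * u))
      = realPsi 1 - Real.log c - expSum c 0 := by
  have hder : HasDerivAt (fun s : ℝ => (1 / c) ^ s * Real.Gamma (s + 1))
      (realPsi 1 - Real.log c) 0 := by
    have h1 : HasDerivAt (fun s : ℝ => Real.Gamma (s + 1))
        (Real.Gamma (0 + 1) * realPsi (0 + 1)) 0 :=
      (hasDerivAt_Gamma_psi (x := 0 + 1) (ne_neg_nat_of_pos (by norm_num))).comp_add_const 0 1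
    have h2 := (hasDerivAt_id (0 : ℝ)).const_rpow (a := 1 / c) (by positivity)
    refine (h2.mul h1).congr_deriv ?_
    simp [Real.Gamma_one, Real.log_inv]
    ring
  have hlim1 := (hasDerivAt_iff_tendsto_slope_zero.mp hder).mono_left
    (nhdsWithin_mono 0 (fun x (hx : 0 < x) => hx.ne' : Set.Ioi (0 : ℝ) ⊆ {0}ᶜ))
  have hlim2 : Tendsto (fun s : ℝ => ∑' k : ℕ, if k = 0 then 0 else expCoeff c k / (k + s))
      (𝓝[>] 0) (𝓝 (∑' k : ℕ, if k = 0 then 0 else expCoeff c k / (k + 0))) := by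
    refine tendsto_tsum_of_dominated_convergence (summable_abs_expCoeff c) ?_ ?_
    · intro k
      by_cases hk : k = 0
      · simp [hk]
      · simp only [hk, if_false]
        refine Tendsto.mono_left ?_ nhdsWithin_le_nhds
        have hk' : (k : ℝ) + 0 ≠ 0 := by simpa using hk
        exact (ContinuousAt.div (by fun_prop) (by fun_prop) hk' :
          ContinuousAt (fun s : ℝ => expCoeff c k / (k + s)) 0)
    · filter_upwards [self_mem_nhdsWithin] with s (hs : 0 < s) k
      by_cases hk : k = 0
      · simp [hk]
      · simp only [hk, if_false]
        have hk' : (1 : ℝ) ≤ k := by exact_mod_cast Nat.one_le_iff_ne_zero.mpr hk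
        rw [norm_div, Real.norm_eq_abs, Real.norm_eq_abs, abs_of_pos (by linarith : 0 < (k : ℝ) + s)]
        exact div_le_self (abs_nonneg _) (by linarith)
  have hzero : ∑' k : ℕ, (if k = 0 then 0 else expCoeff c k / ((k : ℝ) + 0)) = expSum c 0 := by
    refine tsum_congr fun k => ?_
    split_ifs with hk <;> simp [hk]
  rw [hzero] at hlim2
  have hlim3 : Tendsto (fun s : ℝ => ∫ u in Ioi (1 : ℝ), u ^ (s - 1) * Real.exp (-(c * u)))
      (𝓝[>] 0) (𝓝 (∫ u in Ioi (1 : ℝ), u ^ (-1 : ℝ) * Real.exp (-(c * u)))) := by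
    refine tendsto_integral_filter_of_dominated_convergence
      (fun u => u ^ (0 : ℝ) * Real.exp (-(c * u))) ?_ ?_ (integrableOn_rpow_mul_exp_Ioi_one hc 0) ?_
    · exact Eventually.of_forall fun s => (by fun_prop : Measurable fun u : ℝ =>
        u ^ (s - 1) * Real.exp (-(c * u))).aestronglyMeasurable
    · filter_upwards [Ioo_mem_nhdsGT (zero_lt_one (α := ℝ))] with s hs
      filter_upwards [ae_restrict_mem measurableSet_Ioi] with u (hu : 1 < u)
      have hu0 : 0 < u := zero_lt_one.trans hu
      rw [Real.norm_eq_abs, abs_of_nonneg (by positivity)]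
      gcongr
      · exact hu.le
      · linarith [hs.2]
    · filter_upwards [ae_restrict_mem measurableSet_Ioi] with u (hu : 1 < u)
      have hu0 : 0 < u := zero_lt_one.trans hu
      refine Tendsto.mono_left ?_ nhdsWithin_le_nhds
      have : ContinuousAt (fun s : ℝ => u ^ (s - 1) * Real.exp (-(c * u))) 0 :=
        (ContinuousAt.rpow (by fun_prop) (by fun_prop) (Or.inl hu0.ne')).mul (by fun_prop)
      simpa using this.tendsto
  refine tendsto_nhds_unique hlim3 ((hlim1.sub hlim2).congr' ?_)
  filter_upwards [self_mem_nhdsWithin] with s (hs : 0 < s)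
  have h2 := (summable_expSum c s).tsum_eq_add_tsum_ite 0
  rw [← expSum] at h2
  simp only [Nat.cast_zero, zero_add, expCoeff, pow_zero, Nat.factorial_zero, Nat.cast_one,
    div_one] at h2
  rw [integral_Ioi_one_rpow_mul_exp hc hs, h2, zero_add, zero_add, Real.Gamma_one,
    Real.Gamma_add_one hs.ne', smul_eq_mul, Real.rpow_zero, one_mul]
  simp only [expCoeff]
  field_simp
  ring

theorem integral_Ioi_one_rpow_neg_recurrence {c : ℝ} (hc : 0 < c) (n : ℕ) :
    ((n : ℝ) + 1) * ∫ u in Ioi (1 : ℝ), u ^ (-((n : ℝ) + 1) - 1) * Real.exp (-(c * u))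
      = Real.exp (-c) - c * ∫ u in Ioi (1 : ℝ), u ^ (-((n : ℝ) + 1)) * Real.exp (-(c * u)) := by
  have hi := integrableOn_rpow_mul_exp_Ioi_one hc
  have hderiv : ∀ u ∈ Ici (1 : ℝ), HasDerivAt (fun u : ℝ => u ^ (-((n : ℝ) + 1)) * Real.exp (-(c * u)))
      (-((n : ℝ) + 1) * (u ^ (-((n : ℝ) + 1) - 1) * Real.exp (-(c * u)))
        - c * (u ^ (-((n : ℝ) + 1)) * Real.exp (-(c * u)))) u := by
    intro u hu
    have hu0 : (0 : ℝ) < u := zero_lt_one.trans_le hu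
    have h1 := Real.hasDerivAt_rpow_const (p := -((n : ℝ) + 1)) (Or.inl hu0.ne')
    have h2 : HasDerivAt (fun u : ℝ => Real.exp (-(c * u))) (Real.exp (-(c * u)) * -(c * 1)) u :=
      (((hasDerivAt_id u).const_mul c).neg).exp
    refine (h1.mul h2).congr_deriv ?_
    ring
  have hint := ((hi (-((n : ℝ) + 1) - 1)).const_mul (-((n : ℝ) + 1))).sub
    ((hi (-((n : ℝ) + 1))).const_mul c)
  have hlim : Tendsto (fun u : ℝ => u ^ (-((n : ℝ) + 1)) * Real.exp (-(c * u))) atTop (𝓝 0) := by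
    simpa only [neg_mul] using tendsto_rpow_mul_exp_neg_mul_atTop_nhds_zero (-((n : ℝ) + 1)) c hc
  have h := integral_Ioi_of_hasDerivAt_of_tendsto' hderiv hint hlim
  rw [integral_sub ((hi _).const_mul _) ((hi _).const_mul _), integral_const_mul,
    integral_const_mul, Real.one_rpow, mul_one, one_mul] at h
  linarith

/-- Integration by parts lowers the exponent and the right side obeys the same recurrence; the step
of `ψ` absorbs the extra `expCoeff c (n + 1)`. -/
theorem integral_Ioi_one_rpow_neg_mul_exp {c : ℝ} (hc : 0 < c) (n : ℕ) :
    ∫ u in Ioi (1 : ℝ), u ^ (-(n : ℝ) - 1) * Real.exp (-(c * u))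
      = expCoeff c n * (realPsi (n + 1) - Real.log c) - expSum c (-n) := by
  induction n with
  | zero =>
    have := integral_Ioi_one_inv_mul_exp hc
    simpa [expCoeff] using this
  | succ n ih =>
    have hn : (n : ℝ) + 1 ≠ 0 := by positivity
    have h1 := integral_Ioi_one_rpow_neg_recurrence hc n
    have h2 := expSum_neg_nat_recurrence c n
    have h3 := expCoeff_succ c n
    have h4 := realPsi_add_one (x := (n : ℝ) + 1) (ne_neg_nat_of_pos (by positivity))
    rw [show -((n : ℝ) + 1) = -(n : ℝ) - 1 by ring, ih] at h1
    refine mul_left_cancel₀ hn ?_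
    push_cast
    rw [show -((n : ℝ) + 1) = -(n : ℝ) - 1 by ring] at h2 ⊢
    rw [h1, h4, mul_sub ((n : ℝ) + 1), h2]
    have h5 : ((n : ℝ) + 1) * (expCoeff c (n + 1) * (realPsi (n + 1) + 1 / (n + 1) - Real.log c))
        = ((n : ℝ) + 1) * expCoeff c (n + 1) * (realPsi (n + 1) - Real.log c)
          + expCoeff c (n + 1) := by
      field_simp
      ring
    rw [h5, h3]
    ring

/-! ### Termwise integration and rearrangement of the double series -/

/-- The part of `∫ u in Ioi 1, u ^ (2N - 1 - 2k) * exp (-cu)` that is singular at `c = 0`. -/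
noncomputable def polarPart (c : ℝ) (N k : ℕ) : ℝ :=
  if k < N then (1 / c) ^ (2 * N - 2 * k) * ((2 * N - 2 * k - 1).factorial : ℝ)
  else expCoeff c (2 * (k - N)) * (realPsi ((2 * (k - N) : ℕ) + 1) - Real.log c)

theorem integral_Ioi_one_eq_polarPart_sub {c : ℝ} (hc : 0 < c) (N k : ℕ) :
    ∫ u in Ioi (1 : ℝ), u ^ (2 * (N : ℝ) - 2 * k - 1) * Real.exp (-(c * u))
      = polarPart c N k - expSum c (2 * N - 2 * k) := by
  rw [polarPart]
  split_ifs with h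
  · obtain ⟨j, rfl⟩ := Nat.exists_eq_add_of_lt h
    have e : 2 * ((k + j + 1 : ℕ) : ℝ) - 2 * k = ((2 * j + 1 : ℕ) : ℝ) + 1 := by push_cast; ring
    have e1 : 2 * (k + j + 1) - 2 * k = 2 * j + 1 + 1 := by omega
    rw [e, e1, integral_Ioi_one_rpow_mul_exp hc (by positivity), Real.Gamma_nat_eq_factorial,
      Nat.add_sub_cancel, ← Nat.cast_add_one, Real.rpow_natCast]
  · obtain ⟨j, rfl⟩ := Nat.exists_eq_add_of_le (not_lt.1 h)
    have e : 2 * (N : ℝ) - 2 * ((N + j : ℕ) : ℝ) = -((2 * j : ℕ) : ℝ) := by push_cast; ring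
    rw [e, integral_Ioi_one_rpow_neg_mul_exp hc, Nat.add_sub_cancel_left]

theorem inv_sq_mem_Ico {u : ℝ} (hu : 1 < u) : (u ^ 2)⁻¹ ∈ Ico (0 : ℝ) 1 :=
  ⟨by positivity, inv_lt_one_of_one_lt₀ (one_lt_pow₀ hu two_ne_zero)⟩

theorem integrableOn_powerExp {c d : ℝ} (hc : 0 < c) (hd : 0 < d) (s : ℝ) :
    IntegrableOn (fun u : ℝ => u ^ s * (1 - (u ^ 2)⁻¹) ^ d * Real.exp (-(c * u)))
      (Ioi 1) := by
  refine Integrable.mono' (integrableOn_rpow_mul_exp_Ioi_one hc s)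
    (by fun_prop : Measurable fun u : ℝ =>
      u ^ s * (1 - (u ^ 2)⁻¹) ^ d * Real.exp (-(c * u))).aestronglyMeasurable ?_
  filter_upwards [ae_restrict_mem measurableSet_Ioi] with u (hu : 1 < u)
  have hu0 : 0 < u := zero_lt_one.trans hu
  have h1 := inv_sq_mem_Ico hu
  have h2 : 0 ≤ 1 - (u ^ 2)⁻¹ := by linarith [h1.2]
  have h3 : (1 - (u ^ 2)⁻¹) ^ d ≤ 1 := Real.rpow_le_one h2 (by linarith [h1.1]) hd.le
  rw [Real.norm_eq_abs, abs_of_nonneg (by positivity)]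
  gcongr
  exact mul_le_of_le_one_right (by positivity) h3

theorem hasSum_integral_powerExp {c d : ℝ} (hc : 0 < c) (hd : 0 < d) (N : ℕ) :
    HasSum (fun k : ℕ => binCoeff d k * (polarPart c N k - expSum c (2 * N - 2 * k)))
      (∫ u in Ioi (1 : ℝ), u ^ (2 * (N : ℝ) - 1) * (1 - (u ^ 2)⁻¹) ^ d * Real.exp (-(c * u))) := by
  have h : HasSum (fun k : ℕ => ∫ u in Ioi (1 : ℝ),
        binCoeff d k * (u ^ (2 * (N : ℝ) - 2 * k - 1) * Real.exp (-(c * u))))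
      (∫ u in Ioi (1 : ℝ), u ^ (2 * (N : ℝ) - 1) * (1 - (u ^ 2)⁻¹) ^ d
        * Real.exp (-(c * u))) := by
    refine hasSum_integral_of_dominated_convergence
      (fun k u => |binCoeff d k| * (u ^ (2 * (N : ℝ) - 1) * Real.exp (-(c * u)))) ?_ ?_ ?_ ?_ ?_
    · intro k
      exact (by fun_prop : Measurable fun u : ℝ => binCoeff d k *
        (u ^ (2 * (N : ℝ) - 2 * k - 1) * Real.exp (-(c * u)))).aestronglyMeasurable
    · intro k
      filter_upwards [ae_restrict_mem measurableSet_Ioi] with u (hu : 1 < u)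
      have hu0 : 0 < u := zero_lt_one.trans hu
      have hk : (0 : ℝ) ≤ k := k.cast_nonneg
      rw [norm_mul, Real.norm_eq_abs, Real.norm_eq_abs,
        abs_of_nonneg (by positivity : 0 ≤ u ^ (2 * (N : ℝ) - 2 * k - 1) * Real.exp (-(c * u)))]
      gcongr
      · exact hu.le
      · linarith
    · exact Eventually.of_forall fun u => (summable_abs_binCoeff hd).mul_right _
    · simp_rw [tsum_mul_right]
      exact (integrableOn_rpow_mul_exp_Ioi_one hc _).const_mul _
    · filter_upwards [ae_restrict_mem measurableSet_Ioi] with u (hu : 1 < u)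
      have hu0 : 0 < u := zero_lt_one.trans hu
      have h1 := inv_sq_mem_Ico hu
      have h2 := (hasSum_binCoeff_mul_pow d h1.1 h1.2).mul_left
        (u ^ (2 * (N : ℝ) - 1) * Real.exp (-(c * u)))
      rw [mul_right_comm] at h2
      refine (congrArg (HasSum · _) (funext fun k => ?_)).mp h2
      have e : u ^ (2 * (N : ℝ) - 2 * k - 1) = u ^ (2 * (N : ℝ) - 1) * ((u ^ 2)⁻¹) ^ k := by
        rw [show 2 * (N : ℝ) - 2 * k - 1 = 2 * (N : ℝ) - 1 - ((2 * k : ℕ) : ℝ) by push_cast; ring,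
          Real.rpow_sub_natCast hu0.ne', inv_pow, ← pow_mul, div_eq_mul_inv]
      rw [e]
      ring
  refine (congrArg (HasSum · _) (funext fun k => ?_)).mp h
  rw [integral_const_mul, integral_Ioi_one_eq_polarPart_sub hc]

/-- The denominators are integers, so each is either zero (and the term vanishes) or at least `1` in
absolute value; a product of two absolutely summable series dominates. -/
theorem summable_double {c d : ℝ} (hd : 0 < d) (N : ℕ) :
    Summable fun p : ℕ × ℕ => binCoeff d p.1 *
      (expCoeff c p.2 / ((p.2 : ℝ) + (2 * N - 2 * p.1))) := by
  refine Summable.of_norm_bounded ((summable_abs_binCoeff hd).mul_of_nonneg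
    (summable_abs_expCoeff c) (fun k => abs_nonneg _) fun m => abs_nonneg _) ?_
  rintro ⟨k, m⟩
  rw [norm_mul, Real.norm_eq_abs]
  refine mul_le_mul_of_nonneg_left ?_ (abs_nonneg _)
  rw [norm_div, Real.norm_eq_abs, Real.norm_eq_abs]
  by_cases h : (m : ℤ) + (2 * N - 2 * k) = 0
  · have : (m : ℝ) + (2 * N - 2 * k) = 0 := by exact_mod_cast h
    simp [this]
  · refine div_le_self (abs_nonneg _) ?_
    have := Int.one_le_abs h
    exact_mod_cast this

theorem betaSum_eq_tsum (d : ℝ) (N m : ℕ) (b : ℝ) :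
    ∑' k : ℕ, binCoeff d k * (b / ((m : ℝ) + (2 * N - 2 * k)))
      = -(1 / 2) * (b * betaSum d (-((m : ℝ) + 2 * N) / 2)) := by
  rw [betaSum, ← tsum_mul_left, ← tsum_mul_left]
  refine tsum_congr fun k => ?_
  have e : (m : ℝ) + (2 * N - 2 * k) = -2 * (k + -((m : ℝ) + 2 * N) / 2) := by ring
  rw [e, div_eq_mul_inv, mul_inv, div_eq_mul_inv]
  ring

theorem summable_expCoeff_mul_betaSum {c d : ℝ} (hd : 0 < d) (N : ℕ) :
    Summable fun m : ℕ => expCoeff c m * betaSum d (-((m : ℝ) + 2 * N) / 2) := by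
  have h := (summable_double (c := c) hd N).prod_symm.prod
  simp only [Prod.fst_swap, Prod.snd_swap, betaSum_eq_tsum] at h
  exact (summable_mul_left_iff (by norm_num)).mp h

theorem hasSum_binCoeff_mul_expSum {c d : ℝ} (hd : 0 < d) (N : ℕ) :
    HasSum (fun k : ℕ => binCoeff d k * expSum c (2 * N - 2 * k))
      (-(1 / 2) * ∑' m : ℕ, expCoeff c m * betaSum d (-((m : ℝ) + 2 * N) / 2)) := by
  have hs := summable_double (c := c) hd N
  have h := hs.prod.hasSum
  rw [← Summable.tsum_comm (f := fun k m : ℕ => binCoeff d k *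
    (expCoeff c m / ((m : ℝ) + (2 * N - 2 * k)))) hs] at h
  simp only [betaSum_eq_tsum, tsum_mul_left] at h
  exact h

/-- The coefficients of the even powers of `c` in the expansion of the transformed integral. -/
noncomputable def evenTerm (c d : ℝ) (N n : ℕ) : ℝ :=
  expCoeff c (2 * n) * (binCoeff d (n + N) * (realPsi (2 * n + 1) - Real.log c)
    + 1 / 2 * betaSum d (-((n + N : ℕ) : ℝ)))

/-- The coefficients of the odd powers of `c` in the expansion of the transformed integral. -/
noncomputable def oddTerm (c d : ℝ) (N j : ℕ) : ℝ :=
  1 / 2 * (expCoeff c (2 * j + 1) * betaSum d (1 / 2 - ((j + N + 1 : ℕ) : ℝ)))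

/-- Adding the summed `expSum` series back leaves only the singular parts. Splitting `m` by parity
separates half-integer from integer arguments of `betaSum`, and the even ones join the logarithmic
parts with `k = n + N`. -/
theorem integral_powerExp {c d : ℝ} (hc : 0 < c) (hd : 0 < d) (N : ℕ) :
    Summable (evenTerm c d N) ∧
    ∫ u in Ioi (1 : ℝ), u ^ (2 * (N : ℝ) - 1) * (1 - (u ^ 2)⁻¹) ^ d * Real.exp (-(c * u))
      = ∑' j, oddTerm c d N j
        + ∑ k ∈ Finset.range N, binCoeff d k *
            ((1 / c) ^ (2 * N - 2 * k) * ((2 * N - 2 * k - 1).factorial : ℝ))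
        + ∑' n, evenTerm c d N n := by
  have h1 := (hasSum_integral_powerExp hc hd N).add (hasSum_binCoeff_mul_expSum (c := c) hd N)
  simp only [mul_sub, sub_add_cancel] at h1
  have hb := summable_expCoeff_mul_betaSum (c := c) hd N
  have he : Summable fun n : ℕ => expCoeff c (2 * n) * betaSum d (-((n + N : ℕ) : ℝ)) := by
    refine (congrArg Summable (funext fun n => ?_)).mp
      (hb.comp_injective (i := fun n : ℕ => 2 * n) (fun a b h => by simpa using h))
    simp only [Function.comp_apply]
    congr 2
    push_cast
    ring
  have ho : Summable fun j : ℕ =>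
      expCoeff c (2 * j + 1) * betaSum d (1 / 2 - ((j + N + 1 : ℕ) : ℝ)) := by
    refine (congrArg Summable (funext fun n => ?_)).mp
      (hb.comp_injective (i := fun n : ℕ => 2 * n + 1) (fun a b h => by simpa using h))
    simp only [Function.comp_apply]
    congr 2
    push_cast
    ring
  have hsplit : ∑' m : ℕ, expCoeff c m * betaSum d (-((m : ℝ) + 2 * N) / 2)
      = ∑' n : ℕ, expCoeff c (2 * n) * betaSum d (-((n + N : ℕ) : ℝ))
        + ∑' j : ℕ, expCoeff c (2 * j + 1) * betaSum d (1 / 2 - ((j + N + 1 : ℕ) : ℝ)) := by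
    refine HasSum.tsum_eq (HasSum.even_add_odd ?_ ?_)
    · refine (congrArg (HasSum · _) (funext fun n => ?_)).mp he.hasSum
      congr 2
      push_cast
      ring
    · refine (congrArg (HasSum · _) (funext fun n => ?_)).mp ho.hasSum
      congr 2
      push_cast
      ring
  have h2 := (hasSum_nat_add_iff' N).mpr h1
  have h3 : ∀ n : ℕ, polarPart c N (n + N)
      = expCoeff c (2 * n) * (realPsi (2 * n + 1) - Real.log c) := by
    intro n
    rw [polarPart, if_neg (by omega), Nat.add_sub_cancel]
    push_cast
    rfl
  have h4 : ∑ k ∈ Finset.range N, binCoeff d k * polarPart c N k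
      = ∑ k ∈ Finset.range N, binCoeff d k *
            ((1 / c) ^ (2 * N - 2 * k) * ((2 * N - 2 * k - 1).factorial : ℝ)) := by
    refine Finset.sum_congr rfl fun k hk => ?_
    rw [polarPart, if_pos (Finset.mem_range.mp hk)]
  simp only [h3, h4] at h2
  have h5 := h2.add (he.hasSum.mul_left (1 / 2))
  have h6 : (fun n : ℕ => binCoeff d (n + N)
        * (expCoeff c (2 * n) * (realPsi (2 * n + 1) - Real.log c))
      + 1 / 2 * (expCoeff c (2 * n) * betaSum d (-((n + N : ℕ) : ℝ)))) = evenTerm c d N := by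
    funext n
    rw [evenTerm]
    ring
  rw [h6] at h5
  refine ⟨h5.summable, ?_⟩
  rw [h5.tsum_eq, hsplit]
  simp only [oddTerm, tsum_mul_left]
  ring

/-! ### Pochhammer identities and convergence of the hypergeometric series -/

theorem Gamma_sub_nat_inv (x : ℝ) (j : ℕ) :
    (Real.Gamma (x - j))⁻¹ = (-1) ^ j * poch (1 - x) j * (Real.Gamma x)⁻¹ := by
  induction j with
  | zero => simp [poch_zero]
  | succ j ih =>
    rw [real_Gamma_inv_eq, poch_succ,
      show x - ((j + 1 : ℕ) : ℝ) + 1 = x - j by push_cast; ring, ih]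
    push_cast
    ring

theorem factorial_two_mul_eq_poch (n : ℕ) :
    ((2 * n).factorial : ℝ) = 4 ^ n * (n.factorial : ℝ) * poch (1 / 2) n := by
  induction n with
  | zero => simp [poch_zero]
  | succ n ih =>
    rw [show 2 * (n + 1) = 2 * n + 1 + 1 by ring, Nat.factorial_succ, Nat.factorial_succ,
      Nat.factorial_succ, poch_succ]
    push_cast
    rw [ih]
    ring

theorem factorial_two_mul_add_one_eq_poch (n : ℕ) :
    ((2 * n + 1).factorial : ℝ) = 4 ^ n * (n.factorial : ℝ) * poch (3 / 2) n := by
  induction n with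
  | zero => simp [poch_zero]
  | succ n ih =>
    rw [show 2 * (n + 1) + 1 = 2 * n + 1 + 1 + 1 by ring, Nat.factorial_succ, Nat.factorial_succ,
      Nat.factorial_succ n, poch_succ]
    push_cast
    rw [ih]
    ring

theorem poch_pos {a : ℝ} (ha : 0 < a) (r : ℕ) : 0 < poch a r := by
  induction r with
  | zero => simp [poch_zero]
  | succ r ih =>
    rw [poch_succ]
    positivity

theorem summable_hyp1F2Term {a b c : ℝ} (z : ℝ) (hb : 1 ≤ b) (hc : 1 ≤ c) :
    Summable (hyp1F2Term a b c z) := by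
  refine summable_of_ratio_norm_eventually_le (r := 1 / 2) (by norm_num) ?_
  -- As `b, c ≥ 1`, the term ratio is at most `(|a| + 1) |z| / (n + 1)`, which this threshold brings
  -- below `1/2`.
  filter_upwards [(tendsto_natCast_atTop_atTop (R := ℝ)).eventually_ge_atTop
    (2 * (|a| + 1) * |z|)] with n hn
  have hn0 : (0 : ℝ) ≤ n := n.cast_nonneg
  have hb' : 0 < b + n := by linarith
  have hc' : 0 < c + n := by linarith
  have hpb := (poch_pos (by linarith : 0 < b) n).ne'
  have hpc := (poch_pos (by linarith : 0 < c) n).ne'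
  have hf : (n.factorial : ℝ) ≠ 0 := by positivity
  have e : hyp1F2Term a b c z (n + 1)
      = ((a + n) * z / ((b + n) * (c + n) * (n + 1))) * hyp1F2Term a b c z n := by
    rw [hyp1F2Term, hyp1F2Term, poch_succ, poch_succ, poch_succ, Nat.factorial_succ]
    push_cast
    field_simp
    ring
  rw [e, norm_mul]
  refine mul_le_mul_of_nonneg_right ?_ (norm_nonneg _)
  rw [norm_div, Real.norm_eq_abs, Real.norm_eq_abs, abs_mul,
    abs_of_pos (by positivity : 0 < (b + n) * (c + n) * ((n : ℝ) + 1)), div_le_iff₀ (by positivity)]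
  have h1 : |a + n| ≤ (|a| + 1) * (n + 1) := by
    refine (abs_add_le _ _).trans ?_
    rw [abs_of_nonneg hn0]
    nlinarith [abs_nonneg a]
  have h2 : |a + n| * |z| ≤ (|a| + 1) * (n + 1) * |z| :=
    mul_le_mul_of_nonneg_right h1 (abs_nonneg _)
  have h3 : (1 : ℝ) ≤ (b + n) * (c + n) := one_le_mul_of_one_le_of_one_le (by linarith) (by linarith)
  have h4 : ((n : ℝ) + 1) ≤ (b + n) * (c + n) := by nlinarith
  have h5 : ((n : ℝ) + 1) * (n + 1) ≤ (b + n) * (c + n) * (n + 1) :=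
    mul_le_mul_of_nonneg_right h4 (by linarith)
  nlinarith

/-! ### The substitution `t = u⁻²` -/

theorem powerExp_substitution {c d : ℝ} (hc : 0 < c) (hd : 0 < d) (N : ℕ) :
    IntervalIntegrable (fun t : ℝ => t ^ (-(N : ℝ) - 1) * (1 - t) ^ d
      * Real.exp (-(c * t ^ (-(1 / 2) : ℝ)))) volume 0 1 ∧
    ∫ t in (0 : ℝ)..1, t ^ (-(N : ℝ) - 1) * (1 - t) ^ d * Real.exp (-(c * t ^ (-(1 / 2) : ℝ)))
      = 2 * ∫ u in Ioi (1 : ℝ),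
          u ^ (2 * (N : ℝ) - 1) * (1 - (u ^ 2)⁻¹) ^ d * Real.exp (-(c * u)) := by
  set F : ℝ → ℝ := fun u => u ^ (2 * (N : ℝ) - 1) * (1 - (u ^ 2)⁻¹) ^ d * Real.exp (-(c * u))
    with hF
  set h : ℝ → ℝ := fun t => t ^ (-(N : ℝ) - 1) * (1 - t) ^ d
      * Real.exp (-(c * t ^ (-(1 / 2) : ℝ))) with hh
  have hp : (-(1 / 2) : ℝ) ≠ 0 := by norm_num
  -- Indicators carry the power substitution from `(0, ∞)` to the correspondence between `(0, 1)`
  -- and `(1, ∞)`.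
  have key : ∀ t ∈ Ioi (0 : ℝ), (|(-(1 / 2) : ℝ)| * t ^ (-(1 / 2) - 1 : ℝ))
      • (Ioi (1 : ℝ)).indicator F (t ^ (-(1 / 2) : ℝ))
      = (Ioo (0 : ℝ) 1).indicator (fun t => 1 / 2 * h t) t := by
    intro t (ht : 0 < t)
    by_cases ht1 : t < 1
    · have h1 : t ^ (-(1 / 2) : ℝ) ∈ Ioi (1 : ℝ) :=
        Real.one_lt_rpow_of_pos_of_lt_one_of_neg ht ht1 (by norm_num)
      rw [indicator_of_mem h1, indicator_of_mem (show t ∈ Ioo (0 : ℝ) 1 from ⟨ht, ht1⟩), hF, hh]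
      have h2 : ((t ^ (-(1 / 2) : ℝ)) ^ 2)⁻¹ = t := by
        rw [← Real.rpow_natCast, ← Real.rpow_mul ht.le]
        norm_num [Real.rpow_neg_one]
      have h3 : t ^ (-(N : ℝ) - 1)
          = t ^ (-(1 / 2) - 1 : ℝ) * (t ^ (-(1 / 2) : ℝ)) ^ (2 * (N : ℝ) - 1) := by
        rw [← Real.rpow_mul ht.le, ← Real.rpow_add ht]
        ring_nf
      have h4 : |(-(1 / 2) : ℝ)| = 1 / 2 := by norm_num [abs_of_neg]
      simp only [smul_eq_mul]
      rw [h2, h3, h4]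
      ring
    · have h1 : t ^ (-(1 / 2) : ℝ) ∉ Ioi (1 : ℝ) :=
        not_lt.2 (Real.rpow_le_one_of_one_le_of_nonpos (not_lt.1 ht1) (by norm_num))
      rw [indicator_of_notMem h1, indicator_of_notMem (fun hm => ht1 hm.2), smul_zero]
  have hint := (integrableOn_Ioi_comp_rpow_iff ((Ioi (1 : ℝ)).indicator F) hp).mpr
    ((integrable_indicator_iff measurableSet_Ioi).mpr
      (integrableOn_powerExp hc hd _)).integrableOn
  have heq := integral_comp_rpow_Ioi ((Ioi (1 : ℝ)).indicator F) hp
  rw [integrableOn_congr_fun key measurableSet_Ioi] at hint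
  rw [setIntegral_congr_fun measurableSet_Ioi key, setIntegral_indicator measurableSet_Ioo,
    setIntegral_indicator measurableSet_Ioi, inter_eq_right.mpr Ioo_subset_Ioi_self,
    inter_eq_right.mpr (Ioi_subset_Ioi zero_le_one), integral_const_mul] at heq
  constructor
  · rw [intervalIntegrable_iff_integrableOn_Ioo_of_le zero_le_one]
    have h1 : IntegrableOn (fun t => 1 / 2 * h t) (Ioo 0 1) := by
      have := hint.mono_set (Ioo_subset_Ioi_self : Ioo (0 : ℝ) 1 ⊆ Ioi 0)
      exact (integrableOn_congr_fun
        (fun t ht => indicator_of_mem ht _) measurableSet_Ioo).mp this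
    refine IntegrableOn.congr_fun (h1.const_mul 2) (fun t _ => ?_) measurableSet_Ioo
    simp only [hh]
    ring
  · rw [intervalIntegral.integral_of_le zero_le_one, integral_Ioc_eq_integral_Ioo, ← heq]
    ring

/-! ### Identification of the three groups of terms with `R₁`, `R₂`, `R₃` -/

theorem two_mul_oddTerm {d z : ℝ} (hd : 0 < d) (hz : 0 < z) (N j : ℕ) {ν : ℝ}
    (hν : ν = -(N : ℝ) - 1) :
    2 * oddTerm (2 * √z) d N j = Real.Gamma (d + 1) / √Real.pi *
      (-2 * √Real.pi * Real.Gamma (1 / 2 + ν) / Real.Gamma (3 / 2 + ν + d) * √z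
        * hyp1F2Term (-(1 / 2) - ν - d) (3 / 2) (1 / 2 - ν) z j) := by
  have hx : (1 / 2 : ℝ) - ((j + N + 1 : ℕ) : ℝ) = 1 / 2 + ν - j := by
    rw [hν]
    push_cast
    ring
  have hy : 1 / 2 + ν - (j : ℝ) + d + 1 = 3 / 2 + ν + d - j := by ring
  have hx1 : Real.Gamma (1 / 2 + ν - j)
      = ((-1) ^ j * poch (1 / 2 - ν) j)⁻¹ * Real.Gamma (1 / 2 + ν) := by
    have := congrArg (·⁻¹) (Gamma_sub_nat_inv (1 / 2 + ν) j)
    rw [show 1 - (1 / 2 + ν) = 1 / 2 - ν by ring] at this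
    simpa only [inv_inv, mul_inv] using this
  have hpow : (2 * √z) ^ (2 * j) = 4 ^ j * z ^ j := by
    rw [pow_mul, mul_pow, Real.sq_sqrt hz.le, ← mul_pow]
    norm_num
  have hp1 := (poch_pos (by norm_num : (0 : ℝ) < 3 / 2) j).ne'
  have hp2 : poch (1 / 2 - ν) j ≠ 0 := by
    refine (poch_pos ?_ j).ne'
    have : (0 : ℝ) ≤ N := N.cast_nonneg
    linarith
  have hs : ((-1 : ℝ) ^ j) ≠ 0 := by positivity
  have hpi : √Real.pi ≠ 0 := by positivity
  have hf : (j.factorial : ℝ) ≠ 0 := by positivity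
  rw [oddTerm, betaSum_half_sub hd, hx, hy, hx1, Gamma_sub_nat_inv,
    show 1 - (3 / 2 + ν + d) = -(1 / 2) - ν - d by ring, expCoeff, Odd.neg_pow ⟨j, rfl⟩,
    pow_succ, hpow, factorial_two_mul_add_one_eq_poch, hyp1F2Term, div_eq_mul_inv _ (Real.Gamma (3 / 2 + ν + d))]
  generalize (Real.Gamma (3 / 2 + ν + d))⁻¹ = g
  field_simp

theorem two_mul_polarTerm {d z : ℝ} (hd : 0 < d) (hz : 0 < z) {N k : ℕ} (hk : k < N) {ν : ℝ}
    (hν : ν = -(N : ℝ) - 1) :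
    2 * (binCoeff d k * ((1 / (2 * √z)) ^ (2 * N - 2 * k) * ((2 * N - 2 * k - 1).factorial : ℝ)))
      = Real.Gamma (d + 1) / √Real.pi *
        (Real.Gamma (-1 - ν) * Real.Gamma (-(1 / 2) - ν) / Real.Gamma (1 + d) * (z ^ N)⁻¹
          * (poch (-d) k / ((k.factorial : ℝ) * (poch (3 / 2 + ν) k * poch (2 + ν) k)) * z ^ k)) := by
  have hx1 : (Real.Gamma ((N : ℝ) - k))⁻¹ = (-1) ^ k * poch (2 + ν) k * (Real.Gamma (-1 - ν))⁻¹ := by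
    rw [Gamma_sub_nat_inv, hν]
    ring_nf
  have hx2 : (Real.Gamma ((N : ℝ) - k + 1 / 2))⁻¹
      = (-1) ^ k * poch (3 / 2 + ν) k * (Real.Gamma (-(1 / 2) - ν))⁻¹ := by
    rw [show (N : ℝ) - k + 1 / 2 = (N + 1 / 2) - k by ring, Gamma_sub_nat_inv, hν]
    ring_nf
  have hkN : (k : ℝ) < N := by exact_mod_cast hk
  have hG1 := Real.Gamma_pos_of_pos (by linarith : 0 < (N : ℝ) - k)
  have hG2 := Real.Gamma_pos_of_pos (by linarith : 0 < (N : ℝ) - k + 1 / 2)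
  have hd1 := (Real.Gamma_pos_of_pos (by linarith : 0 < d + 1)).ne'
  have hpi : √Real.pi ≠ 0 := by positivity
  have hf : (k.factorial : ℝ) ≠ 0 := by positivity
  have hs : ((-1 : ℝ) ^ k) ≠ 0 := by positivity
  -- For `k < N` the value `Γ(N - k)` is positive, so its reciprocal, a multiple of `(2+ν)_k`,
  -- cannot vanish.
  have hp1 : poch (2 + ν) k ≠ 0 := by
    intro h
    simp only [h, mul_zero, zero_mul, inv_eq_zero] at hx1
    exact hG1.ne' hx1
  have hp2 : poch (3 / 2 + ν) k ≠ 0 := by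
    intro h
    simp only [h, mul_zero, zero_mul, inv_eq_zero] at hx2
    exact hG2.ne' hx2
  have hinv : ∀ X Y p : ℝ, p ≠ 0 → X⁻¹ = (-1) ^ k * p * Y⁻¹ → Y = (-1) ^ k * p * X := by
    intro X Y p hp h
    rw [← inv_inv X, h]
    field_simp
  have hx1' := hinv _ _ _ hp1 hx1
  have hx2' := hinv _ _ _ hp2 hx2
  obtain ⟨M, rfl⟩ := Nat.exists_eq_add_of_lt hk
  have hM : ((k + M + 1 : ℕ) : ℝ) - k = M + 1 := by push_cast; ring
  -- Duplication splits `(2N-2k-1)! = Γ(2(N-k))` into the two gamma factors of `R₂`.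
  have hdup := Real.Gamma_mul_Gamma_add_half ((M : ℝ) + 1)
  rw [show 2 * ((M : ℝ) + 1) = ((2 * M + 1 : ℕ) : ℝ) + 1 by push_cast; ring,
    Real.Gamma_nat_eq_factorial (2 * M + 1),
    show (1 : ℝ) - (((2 * M + 1 : ℕ) : ℝ) + 1) = -((2 * M + 1 : ℕ) : ℝ) by ring,
    Real.rpow_neg (by norm_num), Real.rpow_natCast] at hdup
  rw [hx1', hx2', hM, show 2 * (k + M + 1) - 2 * k = 2 * (M + 1) by omega,
    show 2 * (M + 1) - 1 = 2 * M + 1 by omega, pow_mul, div_pow, mul_pow, Real.sq_sqrt hz.le,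
    binCoeff, add_comm 1 d]
  have hs3 : (-1 : ℝ) ^ k * (-1) ^ k = 1 := by rw [← mul_pow]; norm_num
  have e : ∀ P Q R S G H : ℝ, Q ≠ 0 → R ≠ 0 →
      Real.Gamma (d + 1) / √Real.pi * ((-1) ^ k * Q * G * ((-1) ^ k * R * H) / Real.Gamma (d + 1)
        * S * (P / ((k.factorial : ℝ) * (R * Q)) * z ^ k))
      = ((-1 : ℝ) ^ k * (-1) ^ k) * (P / (k.factorial : ℝ)) * (G * H) / √Real.pi * S * z ^ k := by
    intro P Q R S G H hQ hR
    field_simp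
  rw [e _ _ _ _ _ _ hp1 hp2, hs3, hdup, div_pow, mul_pow, one_pow]
  have h2 : (2 : ℝ) ^ (2 * M + 1) = 4 ^ M * 2 := by
    rw [pow_succ, pow_mul]
    norm_num
  have h3 : ((2 : ℝ) ^ 2) ^ (M + 1) = 4 ^ M * 4 := by
    rw [pow_succ]
    norm_num
  rw [h2, h3, pow_add z (k + M), pow_add z k]
  field_simp
  ring

theorem expCoeff_even {z : ℝ} (hz : 0 < z) (n : ℕ) :
    expCoeff (2 * √z) (2 * n)
      = z ^ n * ((-1) ^ n * Real.Gamma (1 / 2 - n)) / (√Real.pi * (n.factorial : ℝ)) := by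
  have h := Gamma_sub_nat_inv (1 / 2) n
  rw [Real.Gamma_one_half_eq, show (1 : ℝ) - 1 / 2 = 1 / 2 by norm_num] at h
  have h' := congrArg (·⁻¹) h
  simp only [inv_inv, mul_inv] at h'
  have hp := (poch_pos (by norm_num : (0 : ℝ) < 1 / 2) n).ne'
  have hpi : √Real.pi ≠ 0 := by positivity
  have hf : (n.factorial : ℝ) ≠ 0 := by positivity
  have hs : ((-1 : ℝ) ^ n) ≠ 0 := by positivity
  have hpow : (-(2 * √z)) ^ (2 * n) = 4 ^ n * z ^ n := by
    rw [pow_mul, neg_sq, mul_pow, Real.sq_sqrt hz.le, ← mul_pow]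
    norm_num
  rw [h', expCoeff, hpow, factorial_two_mul_eq_poch]
  field_simp

theorem two_mul_evenTerm {α z : ℝ} (hα : α < 1) (hz : 0 < z) (N n : ℕ) :
    2 * evenTerm (2 * √z) (1 / (1 - α)) N n = Real.Gamma (1 / (1 - α) + 1) / √Real.pi *
      (z ^ n * cutoffLogCoeff (-(N : ℤ) - 1) α z n) := by
  have hd : 0 < 1 / (1 - α) := one_div_pos.mpr (sub_pos.mpr hα)
  obtain ⟨h1, h2⟩ := betaSum_neg_nat hd (n + N)
  have harg : cutoffArg (-(N : ℤ) - 1) α n = 1 / (1 - α) + 1 - ((n + N : ℕ) : ℝ) := by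
    rw [cutoffArg]
    push_cast
    ring
  have hlog : Real.log (2 * √z) = Real.log 2 + Real.log z / 2 := by
    rw [Real.log_mul two_ne_zero (Real.sqrt_pos.mpr hz).ne', Real.log_sqrt hz.le]
  have hC : cutoffC' (-(N : ℤ) - 1) n
      = (-1) ^ N * Real.Gamma (1 / 2 - n) / ((n.factorial : ℝ) * ((n + N).factorial : ℝ)) := by
    rw [cutoffC', show (1 : ℤ) + (-(N : ℤ) - 1) = -(N : ℤ) by ring, zpow_neg, zpow_natCast,
      ← inv_pow, show ((n : ℤ) - (-(N : ℤ) - 1) - 1).toNat = n + N by omega]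
    norm_num
  -- One formula for both branches: `-ψ/Γ` is `(1/Γ)'` off the poles, and at a pole `1/Γ = 0`
  -- removes everything else.
  have hcoeff : cutoffLogCoeff (-(N : ℤ) - 1) α z n
      = cutoffC' (-(N : ℤ) - 1) n * ((-Real.log z + realPsi (1 / 2 - n) + realPsi (1 + n)
          + realPsi (((n + N : ℕ) : ℝ) + 1)) * (Real.Gamma (1 / (1 - α) + 1 - ((n + N : ℕ) : ℝ)))⁻¹
        + derivGammaInv (1 / (1 - α) + 1 - ((n + N : ℕ) : ℝ))) := by
    rw [cutoffLogCoeff]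
    split_ifs with hpole
    · obtain ⟨m, hm⟩ := hpole
      rw [hm, neg_neg, Nat.floor_natCast, ← harg, hm, derivGammaInv_neg_nat,
        Real.Gamma_neg_nat_eq_zero, inv_zero, mul_zero, zero_add]
    · rw [← harg, derivGammaInv_eq_psi (fun m hm => hpole ⟨m, hm⟩), cutoffE', cutoffF',
        show (n : ℝ) - ((-(N : ℤ) - 1 : ℤ) : ℝ) = ((n + N : ℕ) : ℝ) + 1 by push_cast; ring]
      ring
  have hpsi := realPsi_duplication n
  have hs : (-1 : ℝ) ^ (n + N) = (-1) ^ n * (-1) ^ N := pow_add _ _ _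
  rw [hcoeff, hC, evenTerm, h1, h2, hlog, expCoeff_even hz, hs]
  -- The `log 2` here cancels the one in `log c = log 2 + (log z)/2`.
  have hψ : realPsi (2 * n + 1)
      = (realPsi (1 / 2 - n) + realPsi (1 + n) + 2 * Real.log 2) / 2 := by linarith
  rw [hψ]
  generalize (Real.Gamma (1 / (1 - α) + 1 - ((n + N : ℕ) : ℝ)))⁻¹ = g
  generalize derivGammaInv (1 / (1 - α) + 1 - ((n + N : ℕ) : ℝ)) = v
  have hpi : √Real.pi ≠ 0 := by positivity
  have hf : (n.factorial : ℝ) ≠ 0 := by positivity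
  have hf2 : ((n + N).factorial : ℝ) ≠ 0 := by positivity
  have hs3 : (-1 : ℝ) ^ (n * 2) = 1 := (even_two.mul_left n).neg_one_pow
  field_simp
  ring_nf
  simp only [hs3, mul_one]

/-! ### Rescaling to the unit interval and assembly -/

theorem cutoffIntegrand_substitution {α b z : ℝ} (hα : α < 1) (hb : 0 < b)
    (hz : z = (1 - α) * b ^ 2 / 4) (N : ℕ) :
    IntervalIntegrable (cutoffIntegrand (-(N : ℤ) - 1) α b) volume 0 (1 / (1 - α)) ∧
    ∫ x in (0 : ℝ)..(1 / (1 - α)), cutoffIntegrand (-(N : ℤ) - 1) α b x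
      = (1 - α) ^ N * (2 * ∫ u in Ioi (1 : ℝ), u ^ (2 * (N : ℝ) - 1)
          * (1 - (u ^ 2)⁻¹) ^ (1 / (1 - α)) * Real.exp (-(2 * √z * u))) := by
  have hβ : 0 < 1 - α := sub_pos.mpr hα
  have hd : 0 < 1 / (1 - α) := one_div_pos.mpr hβ
  have hz0 : 0 < z := by rw [hz]; positivity
  have hc : 0 < 2 * √z := mul_pos two_pos (Real.sqrt_pos.mpr hz0)
  obtain ⟨h1, h2⟩ := powerExp_substitution hc hd N
  have hsqrt : 2 * √z = b * √(1 - α) := by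
    have h : (2 : ℝ) * √z = √(2 ^ 2 * z) := by
      rw [Real.sqrt_mul (by norm_num), Real.sqrt_sq (by norm_num)]
    have h' : b * √(1 - α) = √(b ^ 2 * (1 - α)) := by
      rw [Real.sqrt_mul (by positivity), Real.sqrt_sq hb.le]
    rw [h, h', hz]
    ring_nf
  -- `x^ν` contributes `(1-α)^(N+1)`; the Jacobian `1/(1-α)` later removes one factor.
  have key : ∀ t ∈ Ioc (0 : ℝ) 1, cutoffIntegrand (-(N : ℤ) - 1) α b (1 / (1 - α) * t)
      = (1 - α) ^ (N + 1) * (t ^ (-(N : ℝ) - 1) * (1 - t) ^ (1 / (1 - α))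
        * Real.exp (-(2 * √z * t ^ (-(1 / 2) : ℝ)))) := by
    intro t ht
    have e1 : (1 / (1 - α) * t) ^ (-(N : ℤ) - 1) = (1 - α) ^ (N + 1) * t ^ (-(N : ℝ) - 1) := by
      have : t ^ (-(N : ℝ) - 1) = t ^ (-(N : ℤ) - 1) := by
        rw [← Real.rpow_intCast]
        push_cast
        rfl
      rw [this, mul_zpow, one_div, inv_zpow', show -(-(N : ℤ) - 1) = ((N + 1 : ℕ) : ℤ) by
        push_cast; ring, zpow_natCast]
    have e2 : 1 - (1 - α) * (1 / (1 - α) * t) = 1 - t := by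
      field_simp
    have e3 : b * (1 / (1 - α) * t) ^ (-(1 / 2) : ℝ) = 2 * √z * t ^ (-(1 / 2) : ℝ) := by
      rw [Real.mul_rpow hd.le ht.1.le, one_div, Real.inv_rpow hβ.le, Real.rpow_neg hβ.le, inv_inv,
        ← Real.sqrt_eq_rpow, hsqrt, mul_assoc]
    rw [cutoffIntegrand, e1, e2, neg_mul, e3]
    ring
  have h3 : IntervalIntegrable
      (fun t => cutoffIntegrand (-(N : ℤ) - 1) α b (1 / (1 - α) * t)) volume 0 1 := by
    refine (h1.const_mul ((1 - α) ^ (N + 1))).congr ?_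
    rw [uIoc_of_le zero_le_one]
    exact fun t ht => (key t ht).symm
  constructor
  · have := h3.comp_mul_left (c := 1 - α)
    have e : (fun x => cutoffIntegrand (-(N : ℤ) - 1) α b (1 / (1 - α) * ((1 - α) * x)))
        = cutoffIntegrand (-(N : ℤ) - 1) α b := by
      funext x
      congr 1
      field_simp
    rwa [e, zero_div] at this
  · have h4 := intervalIntegral.integral_comp_mul_left (a := 0) (b := 1)
      (cutoffIntegrand (-(N : ℤ) - 1) α b) hd.ne'
    rw [mul_zero, mul_one, smul_eq_mul, one_div, inv_inv, ← one_div] at h4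
    have h5 : ∫ t in (0 : ℝ)..1, cutoffIntegrand (-(N : ℤ) - 1) α b (1 / (1 - α) * t)
        = ∫ t in (0 : ℝ)..1, (1 - α) ^ (N + 1) * (t ^ (-(N : ℝ) - 1) * (1 - t) ^ (1 / (1 - α))
          * Real.exp (-(2 * √z * t ^ (-(1 / 2) : ℝ)))) := by
      rw [intervalIntegral.integral_of_le zero_le_one, intervalIntegral.integral_of_le zero_le_one]
      exact setIntegral_congr_fun measurableSet_Ioc key
    rw [h5, intervalIntegral.integral_const_mul, h2, pow_succ'] at h4
    refine mul_left_cancel₀ hβ.ne' ?_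
    rw [← h4]
    ring

theorem mainTheorem8 (ν : ℤ) (hν : ν < 0) (α b : ℝ) (hα : α < 1) (hb : 0 < b)
    (z : ℝ) (hz : z = (1 - α) * b ^ 2 / 4) :
    IntervalIntegrable (cutoffIntegrand ν α b) MeasureTheory.volume 0 (1 / (1 - α)) ∧
    Summable (hyp1F2Term (-(1 / 2) - (ν : ℝ) - 1 / (1 - α)) (3 / 2) (1 / 2 - (ν : ℝ)) z) ∧
    Summable (fun r : ℕ => z ^ r * cutoffLogCoeff ν α z r) ∧
    ∫ x in (0 : ℝ)..(1 / (1 - α)), cutoffIntegrand ν α b x =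
      Real.Gamma (1 / (1 - α) + 1) / (Real.sqrt Real.pi * (1 - α) ^ (ν + 1)) *
        (-2 * Real.sqrt Real.pi * Real.Gamma (1 / 2 + (ν : ℝ))
              / Real.Gamma (3 / 2 + (ν : ℝ) + 1 / (1 - α)) * Real.sqrt z
            * hyp1F2 (-(1 / 2) - (ν : ℝ) - 1 / (1 - α)) (3 / 2) (1 / 2 - (ν : ℝ)) z
          + Real.Gamma (-1 - (ν : ℝ)) * Real.Gamma (-(1 / 2) - (ν : ℝ))
              / Real.Gamma (1 + 1 / (1 - α)) * z ^ (1 + ν)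
            * ∑ r ∈ Finset.range (-ν - 1).toNat,
                poch (-(1 / (1 - α))) r
                  / ((r.factorial : ℝ) * (poch (3 / 2 + (ν : ℝ)) r * poch (2 + (ν : ℝ)) r)) * z ^ r
          + ∑' r : ℕ, z ^ r * cutoffLogCoeff ν α z r) := by
  obtain ⟨N, rfl⟩ : ∃ N : ℕ, ν = -(N : ℤ) - 1 := ⟨(-ν - 1).toNat, by omega⟩
  have hβ : 0 < 1 - α := sub_pos.mpr hα
  have hd : 0 < 1 / (1 - α) := one_div_pos.mpr hβ
  have hz0 : 0 < z := by rw [hz]; positivity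
  have hc : 0 < 2 * √z := mul_pos two_pos (Real.sqrt_pos.mpr hz0)
  obtain ⟨hint, hsub⟩ := cutoffIntegrand_substitution hα hb hz N
  obtain ⟨hsum, hval⟩ := integral_powerExp hc hd N
  set μ : ℝ := ((-(N : ℤ) - 1 : ℤ) : ℝ) with hμ
  have hμ' : μ = -(N : ℝ) - 1 := by rw [hμ]; push_cast; ring
  have hC : Real.Gamma (1 / (1 - α) + 1) / √Real.pi ≠ 0 :=
    div_ne_zero (Real.Gamma_pos_of_pos (by linarith)).ne' (by positivity)
  have hlog : Summable fun r : ℕ => z ^ r * cutoffLogCoeff (-(N : ℤ) - 1) α z r := by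
    refine (summable_mul_left_iff hC).mp ?_
    simpa only [two_mul_evenTerm hα hz0] using hsum.mul_left 2
  refine ⟨hint, summable_hyp1F2Term z (by norm_num) ?_, hlog, ?_⟩
  · have : (0 : ℝ) ≤ N := N.cast_nonneg
    linarith
  · have e1 : (1 - α) ^ (-(N : ℤ) - 1 + 1) = ((1 - α) ^ N)⁻¹ := by
      rw [sub_add_cancel, zpow_neg, zpow_natCast]
    have e2 : z ^ (1 + (-(N : ℤ) - 1)) = (z ^ N)⁻¹ := by
      rw [add_sub_cancel, zpow_neg, zpow_natCast]
    have e3 : (-(-(N : ℤ) - 1) - 1).toNat = N := by omega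
    rw [hsub, hval, mul_add 2, mul_add 2, ← tsum_mul_left, ← tsum_mul_left, Finset.mul_sum,
      tsum_congr fun j => two_mul_oddTerm hd hz0 N j hμ',
      tsum_congr fun n => two_mul_evenTerm hα hz0 N n,
      Finset.sum_congr rfl fun k hk => two_mul_polarTerm hd hz0 (Finset.mem_range.mp hk) hμ',
      tsum_mul_left, tsum_mul_left, tsum_mul_left, ← Finset.mul_sum, ← Finset.mul_sum,
      e1, e2, e3, hyp1F2, ← div_div, div_inv_eq_mul]
    ring
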